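/- A quadrilateral is a point $z=(z_1,z_2,z_3,z_4)\in(\mathbb R^2)^4=\mathbb R^8$, $z_i=(x_i,y_i)$, with indices in $\mathbb Z/4\mathbb Z$. It is nondegenerate if $z_i\ne z_j$ for $i\neq j$ and no three consecutive vertices are collinear. It is convex if, for each $i$, all its vertices lie in one closed half-plane bounded by the line through $z_i,z_{i+1}$. On $\mathbb R^8$ put $$\theta^i=\tfrac12(y_i-y_{i+1})\,d(x_i+x_{i+1})-\tfrac12(x_i-x_{i+1})\,d(y_i+y_{i+1}),\qquad i\in\mathbb Z/4\mathbb Z .$$ A nondegenerate integral manifold is an immersed smooth ($C^\infty$) 2-dimensional manifold $M\to\mathbb R^8$ on which all $\theta^i$ vanish, all of whose points are nondegenerate quadrilaterals, and on which $dx_i\wedge dy_i\neq0$ at every point, for every $i$. **Theorem.** Let $z$ be a nondegenerate convex quadrilateral. Then there is exactly one nondegenerate connected integral manifold containing $z$ (up to passing to open subsets), namely the set $F_z$ of all nondegenerate convex quadrilaterals whose side midpoints coincide with those of $z$, i.e. $\frac{w_i+w_{i+1}}2=\frac{z_i+z_{i+1}}2$ for all $i$. Precisely: $F_z$ contains $z$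 and is a connected, embedded, nondegenerate integral manifold; and the image of every connected nondegenerate integral manifold containing $z$ is a relatively open subset of $F_z$. -/

import Mathlib

open scoped Manifold ContDiff

noncomputable section

/-- The space of (labelled, planar) quadrilaterals: the `i`-th vertex of `z` is `z i = (xᵢ, yᵢ)`,
and the indices are cyclic, `Fin 4` being `ℤ/4ℤ`. As a manifold this is `ℝ⁸`. -/
abbrev Quadrilateral : Type := Fin 4 → ℝ × ℝ

namespace Quadrilateral

/-- Pairwise distinct vertices, and no three consecutive vertices on a line. -/
def Nondegenerate (z : Quadrilateral) : Prop :=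
  (∀ i j, i ≠ j → z i ≠ z j) ∧
  ∀ i, ((z (i - 1)).1 - (z i).1) * ((z i).2 - (z (i + 1)).2) ≠
    ((z i).1 - (z (i + 1)).1) * ((z (i - 1)).2 - (z i).2)

/-- Twice the signed area of the triangle `a b c`; its sign tells on which side of the line `ab`
the point `c` lies. -/
def cross (a b c : ℝ × ℝ) : ℝ :=
  (b.1 - a.1) * (c.2 - a.2) - (c.1 - a.1) * (b.2 - a.2)

/-- A quadrilateral is convex if it lies on one side of the line through each of its sides. -/
def IsConvex (z : Quadrilateral) : Prop :=
  ∀ i, (∀ j, 0 ≤ cross (z i) (z (i + 1)) (z j)) ∨ (∀ j, cross (z i) (z (i + 1)) (z j) ≤ 0)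

/-- The `1`-form `dxⁱ` (the differential of the linear coordinate `xᵢ`). -/
def dx (i : Fin 4) : Quadrilateral →L[ℝ] ℝ :=
  (ContinuousLinearMap.fst ℝ ℝ ℝ).comp (ContinuousLinearMap.proj i)

/-- The `1`-form `dyⁱ` (the differential of the linear coordinate `yᵢ`). -/
def dy (i : Fin 4) : Quadrilateral →L[ℝ] ℝ :=
  (ContinuousLinearMap.snd ℝ ℝ ℝ).comp (ContinuousLinearMap.proj i)

/-- The `1`-form `θⁱ = ½ (yᵢ - yᵢ₊₁) d(xⁱ + xⁱ⁺¹) - ½ (xᵢ - xᵢ₊₁) d(yⁱ + yⁱ⁺¹)`,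
at the quadrilateral `z`. -/
def theta (i : Fin 4) (z : Quadrilateral) : Quadrilateral →L[ℝ] ℝ :=
  ((1 / 2 : ℝ) * ((z i).2 - (z (i + 1)).2)) • (dx i + dx (i + 1)) -
    ((1 / 2 : ℝ) * ((z i).1 - (z (i + 1)).1)) • (dy i + dy (i + 1))

/-- The area form `dxⁱ ∧ dyⁱ`, evaluated on two vectors. -/
def areaForm (i : Fin 4) (v w : Quadrilateral) : ℝ :=
  dx i v * dy i w - dx i w * dy i v

/-- The nondegenerate convex quadrilaterals whose side midpoints are those of `z`. -/
def sameMidpoints (z : Quadrilateral) : Set Quadrilateral :=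
  {w | w.Nondegenerate ∧ w.IsConvex ∧
    ∀ i, midpoint ℝ (w i) (w (i + 1)) = midpoint ℝ (z i) (z (i + 1))}

end Quadrilateral

/-- `f : M → ℝ⁸` is a nondegenerate (immersed) `2`-dimensional integral manifold of the exterior
differential system generated by `θ⁰, …, θ³`: a smooth immersion of a surface `M` on whose tangent
planes all `θⁱ` vanish, whose points are nondegenerate quadrilaterals, and on whose tangent planes
no `dxⁱ ∧ dyⁱ` vanishes. -/
structure IsNondegenerateIntegralManifold {M : Type*} [TopologicalSpace M]
    [ChartedSpace (EuclideanSpace ℝ (Fin 2)) M] (f : M → Quadrilateral) : Prop where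
  contMDiff : ContMDiff (𝓡 2) 𝓘(ℝ, Quadrilateral) ∞ f
  immersion : ∀ p, Function.Injective (mfderiv (𝓡 2) 𝓘(ℝ, Quadrilateral) f p)
  integral : ∀ p (i : Fin 4) (v : TangentSpace (𝓡 2) p),
    Quadrilateral.theta i (f p) (mfderiv (𝓡 2) 𝓘(ℝ, Quadrilateral) f p v) = 0
  nondegenerate : ∀ p, (f p).Nondegenerate
  areaForm_ne_zero : ∀ p (i : Fin 4), ∃ v w : TangentSpace (𝓡 2) p,
    Quadrilateral.areaForm i (mfderiv (𝓡 2) 𝓘(ℝ, Quadrilateral) f p v)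
      (mfderiv (𝓡 2) 𝓘(ℝ, Quadrilateral) f p w) ≠ 0

end

/-! The vanishing of `θⁱ` says that the midpoint of side `i` moves along that side. Since `dθⁱ =
dxᵢ₊₁ ∧ dyᵢ₊₁ - dxᵢ ∧ dyᵢ`, all the area forms agree on an integral manifold; call the common value
`τ`. With `αᵢ` the 1-form measuring the rotation of side `i`, this forces the midpoint of side `i`
to move by a multiple `cᵢ αᵢ` of the side (`exists_shear_coeff`). The theorem amounts to `cᵢ = 0`.

Let `Dᵢ` be twice the signed areas of the triangles of consecutive vertices. Linear algebra in one
tangent plane (`IsIntegralPair.infinitesimal_structure`) reduces the `cᵢ` to two numbers `a`, `b`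
bound by one quadratic relation. It also shows that `w = D₀ + D₂` is constant, that `q = D₂ - D₁`
and `r = D₀ - D₁` satisfy `dq ∧ dr = -8wτ`, and that `α₀`, `α₁` are explicit combinations of `dq`,
`dr`. If `w ≠ 0`, then `q`, `r` are local coordinates, and `dαᵢ = 4τ` becomes one first-order
equation for `a` and one for `b`. Together with the quadratic relation the system is overdetermined
and has no solution with `ab ≠ 0` (`Plane.no_shear_solution`). Hence `a = b = 0` where `qr ≠ 0`, and
by density and continuity the midpoints are stationary everywhere
(`Plane.IsIntegralFamily.stationary`).

Convexity guarantees `w ≠ 0`, and among nondegenerate quadrilaterals it is both an open and a closed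
condition. So a connected integral manifold through `z` stays in `F_z`. A point of `F_z` is
determined by one vertex, and each vertex is an open map on the manifold because `τ ≠ 0`; hence the
image is open in `F_z`. Finally `F_z` is the image of a convex open set of the plane under an affine
embedding, because the `Dᵢ` are affine in its parameter. -/

/-! ### Linear algebra in a single tangent plane -/

/-- If two area forms agree along a side whose midpoint moves along it, the motion of the midpoint
is proportional to the rotation of the side. -/
lemma exists_shear_coeff {p q A A' B B' a a' b b' : ℝ} (hpq : p ≠ 0 ∨ q ≠ 0)
    (h : q * (A + a) = p * (B + b)) (h' : q * (A' + a') = p * (B' + b'))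
    (hτ : a * b' - a' * b = A * B' - A' * B) (h0 : A * B' - A' * B ≠ 0) :
    ∃ c : ℝ, (A + a = c * (p * B - q * A) * p ∧ B + b = c * (p * B - q * A) * q) ∧
      (A' + a' = c * (p * B' - q * A') * p ∧ B' + b' = c * (p * B' - q * A') * q) := by
  have hn : p ^ 2 + q ^ 2 ≠ 0 := by
    rcases hpq with h | h <;> positivity
  obtain ⟨l, hl⟩ : ∃ l, l = (p * (A + a) + q * (B + b)) / (p ^ 2 + q ^ 2) := ⟨_, rfl⟩
  obtain ⟨l', hl'⟩ : ∃ l, l = (p * (A' + a') + q * (B' + b')) / (p ^ 2 + q ^ 2) := ⟨_, rfl⟩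
  have e1 : A + a = l * p := by
    rw [hl]; field_simp; linear_combination q * h
  have e2 : B + b = l * q := by
    rw [hl]; field_simp; linear_combination -p * h
  have e1' : A' + a' = l' * p := by
    rw [hl']; field_simp; linear_combination q * h'
  have e2' : B' + b' = l' * q := by
    rw [hl']; field_simp; linear_combination -p * h'
  -- Read as 1-forms, equality of the area forms at the two ends is `l ∧ α = 0`, where `α = p B - q
  -- A` is the rotation. By `h0`, `α ≠ 0`, so `l` is a multiple of `α`; the factor is read off on a
  -- vector where `α` does not vanish.
  have key : l * (p * B' - q * A') = l' * (p * B - q * A) := by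
    obtain rfl : a = l * p - A := by linarith
    obtain rfl : b = l * q - B := by linarith
    obtain rfl : a' = l' * p - A' := by linarith
    obtain rfl : b' = l' * q - B' := by linarith
    linear_combination -hτ
  by_cases hα : p * B - q * A = 0
  · have hα' : p * B' - q * A' ≠ 0 := by
      intro hα'
      rcases hpq with h | h
      · refine h0 (mul_left_cancel₀ h ?_)
        linear_combination A * hα' - A' * hα
      · refine h0 (mul_left_cancel₀ h ?_)
        linear_combination B * hα' - B' * hα
    have hl0 : l = 0 := by
      have : l * (p * B' - q * A') = 0 := by rw [key, hα, mul_zero]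
      exact (mul_eq_zero.1 this).resolve_right hα'
    refine ⟨l' / (p * B' - q * A'), ⟨?_, ?_⟩, ?_, ?_⟩
    · rw [e1, hα, hl0]; simp
    · rw [e2, hα, hl0]; simp
    · rw [e1', div_mul_cancel₀ _ hα']
    · rw [e2', div_mul_cancel₀ _ hα']
  · have e3 : l / (p * B - q * A) * (p * B' - q * A') = l' := by
      field_simp; linear_combination key
    refine ⟨l / (p * B - q * A), ⟨?_, ?_⟩, ?_, ?_⟩
    · rw [e1, div_mul_cancel₀ _ hα]
    · rw [e2, div_mul_cancel₀ _ hα]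
    · rw [e1', e3]
    · rw [e2', e3]

/-- The linear relation between the rotations of three consecutive sides. -/
lemma three_rotations {x₀ x₁ x₂ x₃ y₀ y₁ y₂ y₃ X₀ X₁ X₂ Y₀ Y₁ Y₂ D D' c α₀ α₁ α₂ : ℝ}
    (hα₀ : α₀ = (x₀ - x₁) * Y₀ - (y₀ - y₁) * X₀)
    (hα₁ : α₁ = (x₁ - x₂) * Y₁ - (y₁ - y₂) * X₁)
    (hα₂ : α₂ = (x₂ - x₃) * Y₂ - (y₂ - y₃) * X₂)
    (hD : D = (x₁ - x₀) * (y₂ - y₀) - (x₂ - x₀) * (y₁ - y₀))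
    (hD' : D' = (x₂ - x₁) * (y₃ - y₁) - (x₃ - x₁) * (y₂ - y₁))
    (h₀ : (y₀ - y₁) * (X₀ + X₁) = (x₀ - x₁) * (Y₀ + Y₁))
    (h₁ : X₁ + X₂ = c * α₁ * (x₁ - x₂)) (h₁' : Y₁ + Y₂ = c * α₁ * (y₁ - y₂)) :
    D' * α₀ + D * α₂ + ((x₀ - x₁) * (y₂ - y₃) - (y₀ - y₁) * (x₂ - x₃) + c * D * D') * α₁ = 0 := by
  obtain rfl : X₂ = c * α₁ * (x₁ - x₂) - X₁ := by linarith
  obtain rfl : Y₂ = c * α₁ * (y₁ - y₂) - Y₁ := by linarith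
  -- Up to a multiple of `α₁`, all three rotations are linear functionals of the velocity `(X₁, Y₁)`
  -- of one vertex, and three functionals on a plane are dependent.
  have e0 : α₀ = (y₀ - y₁) * X₁ - (x₀ - x₁) * Y₁ := by linear_combination hα₀ - h₀
  have e2 : α₂ = (y₂ - y₃) * X₁ - (x₂ - x₃) * Y₁ - c * α₁ * D' := by
    rw [hα₂, hD']; ring
  rw [e2, e0, hD, hD']
  linear_combination ((x₀ - x₁) * (y₂ - y₃) - (y₀ - y₁) * (x₂ - x₃)) * hα₁

/-- Derivative of the area of a triangle of consecutive vertices. -/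
lemma deriv_triangle {x₀ x₁ x₂ y₀ y₁ y₂ X₀ X₁ X₂ Y₀ Y₁ Y₂ D c c' α₀ α₁ : ℝ}
    (hα₀ : α₀ = (x₀ - x₁) * Y₀ - (y₀ - y₁) * X₀)
    (hα₁ : α₁ = (x₁ - x₂) * Y₁ - (y₁ - y₂) * X₁)
    (hD : D = (x₁ - x₀) * (y₂ - y₀) - (x₂ - x₀) * (y₁ - y₀))
    (h₀ : X₀ + X₁ = c * α₀ * (x₀ - x₁)) (h₀' : Y₀ + Y₁ = c * α₀ * (y₀ - y₁))
    (h₁ : X₁ + X₂ = c' * α₁ * (x₁ - x₂)) (h₁' : Y₁ + Y₂ = c' * α₁ * (y₁ - y₂)) :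
    (X₁ - X₀) * (y₂ - y₀) + (x₁ - x₀) * (Y₂ - Y₀) - (X₂ - X₀) * (y₁ - y₀)
      - (x₂ - x₀) * (Y₁ - Y₀) = (2 - D * c') * α₁ - (2 - D * c) * α₀ := by
  have e0 : α₀ = (y₀ - y₁) * X₁ - (x₀ - x₁) * Y₁ := by
    linear_combination hα₀ - (y₀ - y₁) * h₀ + (x₀ - x₁) * h₀'
  obtain rfl : X₂ = c' * α₁ * (x₁ - x₂) - X₁ := by linarith
  obtain rfl : Y₂ = c' * α₁ * (y₁ - y₂) - Y₁ := by linarith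
  obtain rfl : X₀ = c * α₀ * (x₀ - x₁) - X₁ := by linarith
  obtain rfl : Y₀ = c * α₀ * (y₀ - y₁) - Y₁ := by linarith
  rw [hD]
  linear_combination (-2) * hα₁ + 2 * e0

/-- The compatibility conditions between the four proportionality factors. -/
lemma shear_relations {a a' : Fin 4 → ℝ} {D₀ D₁ D₂ D₃ c₀ c₁ c₂ c₃ τ : ℝ} (hτ : τ ≠ 0)
    (hD₀ : D₀ ≠ 0) (hD₁ : D₁ ≠ 0) (hD₂ : D₂ ≠ 0) (hD₃ : D₃ ≠ 0) (hsum : D₀ + D₂ = D₁ + D₃)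
    (w01 : a 0 * a' 1 - a' 0 * a 1 = -(D₀ * τ)) (w12 : a 1 * a' 2 - a' 1 * a 2 = -(D₁ * τ))
    (w23 : a 2 * a' 3 - a' 2 * a 3 = -(D₂ * τ)) (w30 : a 3 * a' 0 - a' 3 * a 0 = -(D₃ * τ))
    (R₀ : D₀ * a 3 + D₃ * a 1 + (D₁ - D₀ + c₀ * D₃ * D₀) * a 0 = 0)
    (R₁ : D₁ * a 0 + D₀ * a 2 + (D₂ - D₁ + c₁ * D₀ * D₁) * a 1 = 0)
    (R₂ : D₂ * a 1 + D₁ * a 3 + (D₃ - D₂ + c₂ * D₁ * D₂) * a 2 = 0)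
    (R₃ : D₃ * a 2 + D₂ * a 0 + (D₀ - D₃ + c₃ * D₂ * D₃) * a 3 = 0)
    (R₀' : D₀ * a' 3 + D₃ * a' 1 + (D₁ - D₀ + c₀ * D₃ * D₀) * a' 0 = 0)
    (R₁' : D₁ * a' 0 + D₀ * a' 2 + (D₂ - D₁ + c₁ * D₀ * D₁) * a' 1 = 0)
    (R₂' : D₂ * a' 1 + D₁ * a' 3 + (D₃ - D₂ + c₂ * D₁ * D₂) * a' 2 = 0)
    (R₃' : D₃ * a' 2 + D₂ * a' 0 + (D₀ - D₃ + c₃ * D₂ * D₃) * a' 3 = 0) :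
    ∃ μ ν : ℝ, c₁ = μ * D₂ * D₃ ∧ c₃ = -(μ * D₀ * D₁) ∧ c₂ = ν * D₀ * D₃ ∧
      c₀ = -(ν * D₁ * D₂) ∧
      μ * ν * (D₀ * D₁ * D₂ * D₃) + μ * (D₀ - D₁) + ν * (D₂ - D₁) = 0 := by
  -- The 2×2 minors of the matrix with rows `a`, `a'`: those of neighbouring columns are given, and
  -- each of the two others is computed from two different relations. Comparison gives `g13` and
  -- `g02`.
  have m02 : a 0 * a' 2 - a' 0 * a 2 = (D₂ - D₁ + c₁ * D₀ * D₁) * τ := by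
    apply mul_left_cancel₀ hD₀
    linear_combination a 0 * R₁' - a' 0 * R₁ - (D₂ - D₁ + c₁ * D₀ * D₁) * w01
  have m02' : a 0 * a' 2 - a' 0 * a 2 = -((D₀ - D₃ + c₃ * D₂ * D₃) * τ) := by
    apply mul_left_cancel₀ hD₃
    linear_combination a 0 * R₃' - a' 0 * R₃ + (D₀ - D₃ + c₃ * D₂ * D₃) * w30
  have m13 : a 1 * a' 3 - a' 1 * a 3 = (D₃ - D₂ + c₂ * D₁ * D₂) * τ := by
    apply mul_left_cancel₀ hD₁
    linear_combination a 1 * R₂' - a' 1 * R₂ - (D₃ - D₂ + c₂ * D₁ * D₂) * w12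
  have m13' : a 1 * a' 3 - a' 1 * a 3 = -((D₁ - D₀ + c₀ * D₃ * D₀) * τ) := by
    apply mul_left_cancel₀ hD₀
    linear_combination a 1 * R₀' - a' 1 * R₀ + (D₁ - D₀ + c₀ * D₃ * D₀) * w01
  have g13 : c₁ * D₀ * D₁ + c₃ * D₂ * D₃ = 0 := by
    apply mul_right_cancel₀ hτ
    linear_combination m02' - m02 - τ * hsum
  have g02 : c₀ * D₃ * D₀ + c₂ * D₁ * D₂ = 0 := by
    apply mul_right_cancel₀ hτ
    linear_combination m13' - m13 + τ * hsum
  have pl : (D₂ - D₁ + c₁ * D₀ * D₁) * (D₃ - D₂ + c₂ * D₁ * D₂) = D₀ * D₂ - D₁ * D₃ := by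
    apply mul_right_cancel₀ (pow_ne_zero 2 hτ)
    -- The Plücker relation between the six minors.
    have : (a 0 * a' 1 - a' 0 * a 1) * (a 2 * a' 3 - a' 2 * a 3)
      - (a 0 * a' 2 - a' 0 * a 2) * (a 1 * a' 3 - a' 1 * a 3)
      - (a 3 * a' 0 - a' 3 * a 0) * (a 1 * a' 2 - a' 1 * a 2) = 0 := by ring
    rw [w01, w23, m02, m13, w30, w12] at this
    linear_combination -this
  -- Once `D₃` is eliminated, the terms of `pl` free of `c₁` and `c₂` cancel, since `(D₂ - D₁)(D₀ -
  -- D₁) = D₀D₂ - D₁D₃`.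
  have e : c₁ * c₂ * D₀ * D₁ * D₂ + c₁ * D₀ * (D₀ - D₁) + c₂ * D₂ * (D₂ - D₁) = 0 := by
    apply mul_left_cancel₀ hD₁
    obtain rfl : D₃ = D₀ + D₂ - D₁ := by linarith
    linear_combination pl
  refine ⟨c₁ / (D₂ * D₃), c₂ / (D₀ * D₃), ?_, ?_, ?_, ?_, ?_⟩
  · field_simp
  · field_simp; linear_combination g13
  · field_simp
  · field_simp; linear_combination g02
  · field_simp
    linear_combination e

section expansion
variable {D₀ D₁ D₂ D₃ w q r E μ ν α₀ α₁ α₂ α₃ d₀ d₁ d₂ : ℝ}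

/-- `R₀` and `R₁` express `α₃` and `α₂` through `α₀` and `α₁`, so the differentials of the areas
expand in these two; the relation `K` collapses the coefficients. The conclusions concern `dw`, `dq`
and `dr`, the last two multiplied by `D₀` to avoid a division. -/
lemma deriv_area_expansion (hw : w = D₀ + D₂) (hq : q = D₂ - D₁) (hr : r = D₀ - D₁)
    (hsum : D₃ = D₀ + D₂ - D₁) (hE : E = (w ^ 2 - q ^ 2 - r ^ 2) / 2) (hD₀ : D₀ ≠ 0)
    (K : μ * ν * (D₀ * D₁ * D₂ * D₃) + μ * r + ν * q = 0)
    (R₀ : D₀ * α₃ + D₃ * α₁ - (r + ν * (D₀ * D₁ * D₂ * D₃)) * α₀ = 0)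
    (R₁ : D₁ * α₀ + D₀ * α₂ + (q + μ * (D₀ * D₁ * D₂ * D₃)) * α₁ = 0)
    (h₀ : d₀ = (2 - D₀ * (μ * D₂ * D₃)) * α₁ - (2 + D₀ * (ν * D₁ * D₂)) * α₀)
    (h₁ : d₁ = (2 - D₁ * (ν * D₀ * D₃)) * α₂ - (2 - D₁ * (μ * D₂ * D₃)) * α₁)
    (h₂ : d₂ = (2 + D₂ * (μ * D₀ * D₁)) * α₃ - (2 - D₂ * (ν * D₀ * D₃)) * α₂) :
    d₀ + d₂ = 0 ∧
    D₀ * (d₂ - d₁) = (2 * (w - q) + ν * D₀ * D₁ * q * r) * α₀ + (2 * q + μ * D₀ * D₃ * E) * α₁ ∧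
    D₀ * (d₀ - d₁) =
      -(2 * r + ν * D₀ * D₁ * E) * α₀ + (2 * (w + r) - μ * D₀ * D₃ * q * r) * α₁ := by
  subst hw hq hr hsum hE h₀ h₁ h₂
  refine ⟨?_, ?_, ?_⟩
  · apply mul_left_cancel₀ hD₀
    linear_combination (2 + D₂ * (μ * D₀ * D₁)) * R₀ - (2 - D₂ * (ν * D₀ * (D₀ + D₂ - D₁))) * R₁
      + (D₀ * D₁ * D₂) * α₀ * K - D₀ * D₂ * (D₀ + D₂ - D₁) * α₁ * K
  · linear_combination (2 + D₂ * (μ * D₀ * D₁)) * R₀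
      - (4 - (D₁ + D₂) * (ν * D₀ * (D₀ + D₂ - D₁))) * R₁
      + (D₀ * D₁ * D₂) * α₀ * K - D₀ * (D₁ + D₂) * (D₀ + D₂ - D₁) * α₁ * K
  · linear_combination  - (2 - D₁ * (ν * D₀ * (D₀ + D₂ - D₁))) * R₁
      - D₀ * D₁ * (D₀ + D₂ - D₁) * α₁ * K

/-- The determinant of the expansion of `deriv_area_expansion`. -/
lemma expansion_det (hw : w = D₀ + D₂) (hq : q = D₂ - D₁) (hr : r = D₀ - D₁)
    (hsum : D₃ = D₀ + D₂ - D₁) (hE : E = (w ^ 2 - q ^ 2 - r ^ 2) / 2)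
    (K : μ * ν * (D₀ * D₁ * D₂ * D₃) + μ * r + ν * q = 0) :
    (2 * (w - q) + ν * D₀ * D₁ * q * r) * (2 * (w + r) - μ * D₀ * D₃ * q * r) +
      (2 * q + μ * D₀ * D₃ * E) * (2 * r + ν * D₀ * D₁ * E) = 8 * w * D₀ := by
  subst hw hq hr hsum hE
  linear_combination 4 * D₀ ^ 2 * D₁ * (D₀ + D₂ - D₁) * K

end expansion

/-- Twice the signed area of the triangle formed by the `i`-th vertex and the next two ones. -/
def triangleArea (x y : Fin 4 → ℝ) (i : Fin 4) : ℝ :=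
  (x (i + 1) - x i) * (y (i + 2) - y i) - (x (i + 2) - x i) * (y (i + 1) - y i)

/-- The derivative of `triangleArea` at `(x, y)` in the direction `(X, Y)`. -/
def triangleAreaDeriv (x y X Y : Fin 4 → ℝ) (i : Fin 4) : ℝ :=
  (X (i + 1) - X i) * (y (i + 2) - y i) + (x (i + 1) - x i) * (Y (i + 2) - Y i)
    - (X (i + 2) - X i) * (y (i + 1) - y i) - (x (i + 2) - x i) * (Y (i + 1) - Y i)

/-- The rotation of the `i`-th side at `(x, y)` in the direction `(X, Y)`. -/
def sideRotation (x y X Y : Fin 4 → ℝ) (i : Fin 4) : ℝ :=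
  (x i - x (i + 1)) * Y i - (y i - y (i + 1)) * X i

lemma triangleArea_sum (x y : Fin 4 → ℝ) :
    triangleArea x y 3 = triangleArea x y 0 + triangleArea x y 2 - triangleArea x y 1 := by
  simp only [triangleArea, show (0 + 1 : Fin 4) = 1 from rfl, show (0 + 2 : Fin 4) = 2 from rfl,
    show (1 + 1 : Fin 4) = 2 from rfl, show (1 + 2 : Fin 4) = 3 from rfl,
    show (2 + 1 : Fin 4) = 3 from rfl, show (2 + 2 : Fin 4) = 0 from rfl,
    show (3 + 1 : Fin 4) = 0 from rfl, show (3 + 2 : Fin 4) = 1 from rfl]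
  ring

/-- The conditions on a pair of tangent vectors of a nondegenerate integral manifold. -/
structure IsIntegralPair (x y X Y X' Y' : Fin 4 → ℝ) (τ : ℝ) : Prop where
  left : ∀ i, (y i - y (i + 1)) * (X i + X (i + 1)) = (x i - x (i + 1)) * (Y i + Y (i + 1))
  right : ∀ i, (y i - y (i + 1)) * (X' i + X' (i + 1)) = (x i - x (i + 1)) * (Y' i + Y' (i + 1))
  area : ∀ i, X i * Y' i - X' i * Y i = τ
  area_ne_zero : τ ≠ 0

namespace IsIntegralPair
variable {x y X Y X' Y' : Fin 4 → ℝ} {τ : ℝ}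

/-- Since `θⁱ` vanishes, the rotation of side `i` can be computed, up to sign, from its other end.
At the common vertex `i + 1` both rotations are then functionals of one velocity, and their wedge is
the determinant of the two sides times the area form. -/
lemma rotation_wedge (h : IsIntegralPair x y X Y X' Y' τ) (i : Fin 4) :
    sideRotation x y X Y i * sideRotation x y X' Y' (i + 1) -
      sideRotation x y X' Y' i * sideRotation x y X Y (i + 1) = -(triangleArea x y i * τ) := by
  have h1 := h.left i
  have h2 := h.right i
  have h3 := h.area (i + 1)
  have e : sideRotation x y X Y i = (y i - y (i + 1)) * X (i + 1) - (x i - x (i + 1)) * Y (i + 1) := by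
    unfold sideRotation; linear_combination -h1
  have e' : sideRotation x y X' Y' i =
      (y i - y (i + 1)) * X' (i + 1) - (x i - x (i + 1)) * Y' (i + 1) := by
    unfold sideRotation; linear_combination -h2
  rw [e, e', ← h3]
  simp only [sideRotation, triangleArea, show i + 1 + 1 = i + 2 by rw [add_assoc]; rfl]
  ring

/-- The same `c i` serves both vectors, so this is a proportionality of 1-forms on the tangent
plane. -/
lemma exists_coeff (h : IsIntegralPair x y X Y X' Y' τ) (hD : ∀ i, triangleArea x y i ≠ 0) :
    ∃ c : Fin 4 → ℝ, ∀ i,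
      (X i + X (i + 1) = c i * sideRotation x y X Y i * (x i - x (i + 1)) ∧
       Y i + Y (i + 1) = c i * sideRotation x y X Y i * (y i - y (i + 1))) ∧
      (X' i + X' (i + 1) = c i * sideRotation x y X' Y' i * (x i - x (i + 1)) ∧
       Y' i + Y' (i + 1) = c i * sideRotation x y X' Y' i * (y i - y (i + 1))) := by
  have : ∀ i, ∃ c : ℝ,
      (X i + X (i + 1) = c * sideRotation x y X Y i * (x i - x (i + 1)) ∧
       Y i + Y (i + 1) = c * sideRotation x y X Y i * (y i - y (i + 1))) ∧
      (X' i + X' (i + 1) = c * sideRotation x y X' Y' i * (x i - x (i + 1)) ∧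
       Y' i + Y' (i + 1) = c * sideRotation x y X' Y' i * (y i - y (i + 1))) := by
    intro i
    refine exists_shear_coeff ?_ (h.left i) (h.right i) ?_ ?_
    · by_contra! hc
      refine hD i ?_
      unfold triangleArea
      linear_combination -(y (i + 2) - y i) * hc.1 + (x (i + 2) - x i) * hc.2
    · rw [h.area, h.area]
    · rw [h.area]; exact h.area_ne_zero
  exact Classical.axiom_of_choice this

/-- Linear relations between the rotations of the sides and the derivatives of the areas, when the
midpoints move along the sides. -/
lemma rotation_relations {c : Fin 4 → ℝ}
    (hc : ∀ i, X i + X (i + 1) = c i * sideRotation x y X Y i * (x i - x (i + 1)) ∧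
        Y i + Y (i + 1) = c i * sideRotation x y X Y i * (y i - y (i + 1))) :
    (∀ i, triangleArea x y (i + 1) * sideRotation x y X Y i
        + triangleArea x y i * sideRotation x y X Y (i + 2)
        + (triangleArea x y (i + 2) - triangleArea x y (i + 1)
          + c (i + 1) * triangleArea x y i * triangleArea x y (i + 1))
            * sideRotation x y X Y (i + 1) = 0) ∧
      ∀ i, triangleAreaDeriv x y X Y i =
        (2 - triangleArea x y i * c (i + 1)) * sideRotation x y X Y (i + 1) -
          (2 - triangleArea x y i * c i) * sideRotation x y X Y i := by
  refine ⟨fun i => ?_, fun i => ?_⟩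
  · have e1 : i + 1 + 1 = i + 2 := by rw [add_assoc]; rfl
    have e2 : i + 1 + 2 = i + 3 := by rw [add_assoc]; rfl
    have e3 : i + 2 + 1 = i + 3 := by rw [add_assoc]; rfl
    have e4 : i + 2 + 2 = i := by rw [add_assoc]; exact add_zero i
    have := three_rotations (x₀ := x i) (x₁ := x (i + 1)) (x₂ := x (i + 2)) (x₃ := x (i + 3))
      (y₀ := y i) (y₁ := y (i + 1)) (y₂ := y (i + 2)) (y₃ := y (i + 3))
      (X₀ := X i) (X₁ := X (i + 1)) (X₂ := X (i + 2))
      (Y₀ := Y i) (Y₁ := Y (i + 1)) (Y₂ := Y (i + 2)) (c := c (i + 1))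
      (D := triangleArea x y i) (D' := triangleArea x y (i + 1))
      (α₀ := sideRotation x y X Y i) (α₁ := sideRotation x y X Y (i + 1))
      (α₂ := sideRotation x y X Y (i + 2)) rfl (by simp only [sideRotation, e1])
      (by simp only [sideRotation, e3]) rfl (by simp only [triangleArea, e1, e2])
      (by rw [(hc i).1, (hc i).2]; ring)
      (by have := (hc (i + 1)).1; rwa [e1] at this) (by have := (hc (i + 1)).2; rwa [e1] at this)
    have e5 : triangleArea x y (i + 2) - triangleArea x y (i + 1) =
        (x i - x (i + 1)) * (y (i + 2) - y (i + 3)) -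
          (y i - y (i + 1)) * (x (i + 2) - x (i + 3)) := by
      simp only [triangleArea, e1, e2, e3, e4]; ring
    rw [e5]; exact this
  · have e1 : i + 1 + 1 = i + 2 := by rw [add_assoc]; rfl
    exact deriv_triangle (α₀ := sideRotation x y X Y i) (α₁ := sideRotation x y X Y (i + 1))
      rfl (by simp only [sideRotation, e1]) rfl (hc i).1 (hc i).2
      (by have := (hc (i + 1)).1; rwa [e1] at this) (by have := (hc (i + 1)).2; rwa [e1] at this)

/-- The infinitesimal structure of a nondegenerate integral manifold. With `w` the area of the
quadrilateral, `q` and `r` two differences of areas and `E = (w² - q² - r²) / 2`, the pair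
`(a, b)` measures how far the midpoints are from being stationary. -/
theorem infinitesimal_structure (h : IsIntegralPair x y X Y X' Y' τ)
    (hD : ∀ i, triangleArea x y i ≠ 0) {D dD dD' : Fin 4 → ℝ} {w q r E : ℝ}
    (hDe : D = triangleArea x y) (hdD : dD = triangleAreaDeriv x y X Y)
    (hdD' : dD' = triangleAreaDeriv x y X' Y')
    (hw : w = D 0 + D 2) (hq : q = D 2 - D 1) (hr : r = D 0 - D 1)
    (hE : E = (w ^ 2 - q ^ 2 - r ^ 2) / 2) :
    ∃ a b : ℝ, a * b * (D 1 * D 2 * D 3) + a * D 1 * r + b * D 3 * q = 0 ∧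
      (dD 0 + dD 2 = 0 ∧ dD' 0 + dD' 2 = 0) ∧
      (dD 2 - dD 1) * (dD' 0 - dD' 1) - (dD' 2 - dD' 1) * (dD 0 - dD 1) = -(8 * w * τ) ∧
      (8 * w * sideRotation x y X Y 0 =
        (2 * (w + r) - a * q * r) * (dD 2 - dD 1) - (2 * q + a * E) * (dD 0 - dD 1) ∧
       8 * w * sideRotation x y X' Y' 0 =
        (2 * (w + r) - a * q * r) * (dD' 2 - dD' 1) - (2 * q + a * E) * (dD' 0 - dD' 1)) ∧
      (8 * w * sideRotation x y X Y 1 =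
        (2 * r + b * E) * (dD 2 - dD 1) + (2 * (w - q) + b * q * r) * (dD 0 - dD 1) ∧
       8 * w * sideRotation x y X' Y' 1 =
        (2 * r + b * E) * (dD' 2 - dD' 1) + (2 * (w - q) + b * q * r) * (dD' 0 - dD' 1)) ∧
      (a = 0 → b = 0 → ∀ i, (X i + X (i + 1) = 0 ∧ Y i + Y (i + 1) = 0) ∧
        (X' i + X' (i + 1) = 0 ∧ Y' i + Y' (i + 1) = 0)) := by
  obtain ⟨c, hc⟩ := h.exists_coeff hD
  have hsum : D 3 = D 0 + D 2 - D 1 := by rw [hDe]; exact triangleArea_sum x y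
  obtain ⟨R, dR⟩ := rotation_relations fun i => (hc i).1
  obtain ⟨R', dR'⟩ := rotation_relations fun i => (hc i).2
  have hW := h.rotation_wedge
  rw [← hDe] at R dR R' dR' hD
  simp only [← hDe] at hW
  rw [← hdD] at dR
  rw [← hdD'] at dR'
  obtain ⟨α, hα⟩ : ∃ α, α = sideRotation x y X Y := ⟨_, rfl⟩
  obtain ⟨α', hα'⟩ : ∃ α, α = sideRotation x y X' Y' := ⟨_, rfl⟩
  simp only [← hα, ← hα'] at R dR R' dR' hW hc ⊢
  have hτ := h.area_ne_zero
  -- The relation `R i` is centred at side `i + 1`; the one centred at side 0 is therefore `R 3`.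
  have hR0 : D 0 * α 3 + D 3 * α 1 + (D 1 - D 0 + c 0 * D 3 * D 0) * α 0 = 0 := R 3
  have hR1 : D 1 * α 0 + D 0 * α 2 + (D 2 - D 1 + c 1 * D 0 * D 1) * α 1 = 0 := R 0
  have hR0' : D 0 * α' 3 + D 3 * α' 1 + (D 1 - D 0 + c 0 * D 3 * D 0) * α' 0 = 0 := R' 3
  have hR1' : D 1 * α' 0 + D 0 * α' 2 + (D 2 - D 1 + c 1 * D 0 * D 1) * α' 1 = 0 := R' 0
  obtain ⟨μ, ν, h1, h3, h2, h0, K⟩ := shear_relations (a := α) (a' := α') (c₀ := c 0) (c₁ := c 1)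
    (c₂ := c 2) (c₃ := c 3) hτ (hD 0) (hD 1) (hD 2) (hD 3) (by linarith)
    (hW 0) (hW 1) (hW 2) (hW 3) hR0 hR1 (R 1) (R 2) hR0' hR1' (R' 1) (R' 2)
  have d0 : dD 0 = (2 - D 0 * c 1) * α 1 - (2 - D 0 * c 0) * α 0 := dR 0
  have d1 : dD 1 = (2 - D 1 * c 2) * α 2 - (2 - D 1 * c 1) * α 1 := dR 1
  have d2 : dD 2 = (2 - D 2 * c 3) * α 3 - (2 - D 2 * c 2) * α 2 := dR 2
  have d0' : dD' 0 = (2 - D 0 * c 1) * α' 1 - (2 - D 0 * c 0) * α' 0 := dR' 0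
  have d1' : dD' 1 = (2 - D 1 * c 2) * α' 2 - (2 - D 1 * c 1) * α' 1 := dR' 1
  have d2' : dD' 2 = (2 - D 2 * c 3) * α' 3 - (2 - D 2 * c 2) * α' 2 := dR' 2
  rw [← hr, ← hq] at K
  obtain ⟨e1, e2, e3⟩ := deriv_area_expansion (α₀ := α 0) (α₁ := α 1) (α₂ := α 2) (α₃ := α 3)
    (d₀ := dD 0) (d₁ := dD 1) (d₂ := dD 2) hw hq hr hsum hE (hD 0) K
    (by rw [← hR0, h0, hr]; ring) (by rw [← hR1, h1, hq]; ring) (by rw [d0, h1, h0]; ring)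
    (by rw [d1, h2, h1]) (by rw [d2, h2, h3]; ring)
  obtain ⟨e1', e2', e3'⟩ := deriv_area_expansion (α₀ := α' 0) (α₁ := α' 1) (α₂ := α' 2)
    (α₃ := α' 3)
    (d₀ := dD' 0) (d₁ := dD' 1) (d₂ := dD' 2) hw hq hr hsum hE (hD 0) K
    (by rw [← hR0', h0, hr]; ring) (by rw [← hR1', h1, hq]; ring) (by rw [d0', h1, h0]; ring)
    (by rw [d1', h2, h1]) (by rw [d2', h2, h3]; ring)
  have hdet := expansion_det hw hq hr hsum hE K
  -- With this scaling the coefficients of the expansion depend only on `w`, `q`, `r`, `a`, `b`.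
  refine ⟨μ * D 0 * D 3, ν * D 0 * D 1, by linear_combination D 0 * D 1 * D 3 * K, ⟨e1, e1'⟩, ?_,
    ⟨?_, ?_⟩, ⟨?_, ?_⟩, fun ha hb => ?_⟩
  · apply mul_left_cancel₀ (pow_ne_zero 2 (hD 0))
    obtain ⟨A1, hA1⟩ : ∃ t, t = 2 * (w - q) + ν * D 0 * D 1 * q * r := ⟨_, rfl⟩
    obtain ⟨A2, hA2⟩ : ∃ t, t = 2 * q + μ * D 0 * D 3 * E := ⟨_, rfl⟩
    obtain ⟨B1, hB1⟩ : ∃ t, t = 2 * r + ν * D 0 * D 1 * E := ⟨_, rfl⟩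
    obtain ⟨B2, hB2⟩ : ∃ t, t = 2 * (w + r) - μ * D 0 * D 3 * q * r := ⟨_, rfl⟩
    rw [← hA1, ← hA2] at e2 e2'
    rw [← hB1, ← hB2] at e3 e3'
    rw [← hA1, ← hA2, ← hB1, ← hB2] at hdet
    have hW0 : α 0 * α' 1 - α' 0 * α 1 = -(D 0 * τ) := hW 0
    calc _ = (D 0 * (dD 2 - dD 1)) * (D 0 * (dD' 0 - dD' 1))
          - (D 0 * (dD' 2 - dD' 1)) * (D 0 * (dD 0 - dD 1)) := by ring
      _ = _ := by
        rw [e2, e3, e2', e3']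
        linear_combination (A1 * B2 + A2 * B1) * hW0 - D 0 * τ * hdet
  -- This and the next three identities invert the expansion by Cramer's rule, with the determinant
  -- `hdet`.
  · apply mul_left_cancel₀ (hD 0)
    linear_combination -(2 * (w + r) - μ * D 0 * D 3 * q * r) * e2
      + (2 * q + μ * D 0 * D 3 * E) * e3 - α 0 * hdet
  · apply mul_left_cancel₀ (hD 0)
    linear_combination -(2 * (w + r) - μ * D 0 * D 3 * q * r) * e2'
      + (2 * q + μ * D 0 * D 3 * E) * e3' - α' 0 * hdet
  · apply mul_left_cancel₀ (hD 0)
    linear_combination -(2 * r + ν * D 0 * D 1 * E) * e2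
      - (2 * (w - q) + ν * D 0 * D 1 * q * r) * e3 - α 1 * hdet
  · apply mul_left_cancel₀ (hD 0)
    linear_combination -(2 * r + ν * D 0 * D 1 * E) * e2'
      - (2 * (w - q) + ν * D 0 * D 1 * q * r) * e3' - α' 1 * hdet
  · have hμ : μ = 0 := by simpa [hD 0, hD 3] using ha
    have hν : ν = 0 := by simpa [hD 0, hD 1] using hb
    have hc0 : ∀ i, c i = 0 := by
      intro i
      fin_cases i
      · exact h0.trans (by simp [hν])
      · exact h1.trans (by simp [hμ])
      · exact h2.trans (by simp [hν])
      · exact h3.trans (by simp [hμ])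
    intro i
    have := hc i
    simpa only [hc0 i, zero_mul] using this

end IsIntegralPair

/-! ### Jacobians as exterior calculus on the plane -/

/-- The Euclidean plane. -/
abbrev Plane : Type := EuclideanSpace ℝ (Fin 2)

namespace Plane

/-- The Jacobian determinant of a pair of functions on the plane. -/
noncomputable def jac (f g : Plane → ℝ) (p : Plane) : ℝ :=
  fderiv ℝ f p (EuclideanSpace.single 0 1) * fderiv ℝ g p (EuclideanSpace.single 1 1) -
    fderiv ℝ f p (EuclideanSpace.single 1 1) * fderiv ℝ g p (EuclideanSpace.single 0 1)

section jac
variable {f g h : Plane → ℝ} {p : Plane}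

lemma jac_self : jac f f p = 0 := by unfold jac; ring

lemma jac_swap : jac f g p = -jac g f p := by unfold jac; ring

lemma jac_const (c : ℝ) : jac (fun _ => c) h p = 0 := by simp [jac]

lemma jac_add (hf : DifferentiableAt ℝ f p) (hg : DifferentiableAt ℝ g p) :
    jac (fun x => f x + g x) h p = jac f h p + jac g h p := by
  simp only [jac, fderiv_fun_add hf hg, add_apply]; ring

lemma jac_sub (hf : DifferentiableAt ℝ f p) (hg : DifferentiableAt ℝ g p) :
    jac (fun x => f x - g x) h p = jac f h p - jac g h p := by
  simp only [jac, fderiv_fun_sub hf hg, sub_apply]; ring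

lemma jac_neg : jac (fun x => -f x) h p = -jac f h p := by
  simp only [jac, fderiv_fun_neg, neg_apply]; ring

lemma jac_mul (hf : DifferentiableAt ℝ f p) (hg : DifferentiableAt ℝ g p) :
    jac (fun x => f x * g x) h p = f p * jac g h p + g p * jac f h p := by
  simp only [jac, fderiv_fun_mul hf hg, add_apply,
    smul_apply, smul_eq_mul]; ring

lemma jac_sq (hf : DifferentiableAt ℝ f p) :
    jac (fun x => f x ^ 2) h p = 2 * f p * jac f h p := by
  simp only [pow_two, jac_mul hf hf]; ring

lemma jac_inv (hf : DifferentiableAt ℝ f p) (h0 : f p ≠ 0) :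
    f p ^ 2 * jac (fun x => (f x)⁻¹) h p = -jac f h p := by
  have := (hasDerivAt_inv h0).comp_hasFDerivAt p hf.hasFDerivAt
  have e : fderiv ℝ (fun x => (f x)⁻¹) p = (-(f p ^ 2)⁻¹) • fderiv ℝ f p := this.fderiv
  simp only [jac, e, smul_apply, smul_eq_mul]
  field_simp
  ring

lemma jac_congr {U : Set Plane} (hU : IsOpen U) (hp : p ∈ U) (hfg : ∀ x ∈ U, f x = g x) :
    jac f h p = jac g h p := by
  have : f =ᶠ[nhds p] g := Filter.eventuallyEq_of_mem (hU.mem_nhds hp) hfg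
  simp only [jac, this.fderiv_eq]

lemma apply_eq_coords (φ : Plane →L[ℝ] ℝ) (v : Plane) :
    φ v = v 0 * φ (EuclideanSpace.single 0 1) + v 1 * φ (EuclideanSpace.single 1 1) := by
  have : v = v 0 • EuclideanSpace.single 0 (1 : ℝ) + v 1 • EuclideanSpace.single 1 (1 : ℝ) := by
    ext i; fin_cases i <;> simp
  conv_lhs => rw [this]
  simp

/-- Two functions with nonvanishing Jacobian separate covectors. -/
lemma covector_eq_zero {φ : Plane →L[ℝ] ℝ} (h0 : jac f g p ≠ 0)
    (hf : φ (EuclideanSpace.single 0 1) * fderiv ℝ f p (EuclideanSpace.single 1 1) -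
      φ (EuclideanSpace.single 1 1) * fderiv ℝ f p (EuclideanSpace.single 0 1) = 0)
    (hg : φ (EuclideanSpace.single 0 1) * fderiv ℝ g p (EuclideanSpace.single 1 1) -
      φ (EuclideanSpace.single 1 1) * fderiv ℝ g p (EuclideanSpace.single 0 1) = 0) : φ = 0 := by
  ext v
  rw [apply_eq_coords φ v]
  have e0 : φ (EuclideanSpace.single 0 1) = 0 := by
    apply mul_left_cancel₀ h0
    unfold jac
    linear_combination fderiv ℝ f p (EuclideanSpace.single 0 1) * hg
      - fderiv ℝ g p (EuclideanSpace.single 0 1) * hf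
  have e1 : φ (EuclideanSpace.single 1 1) = 0 := by
    apply mul_left_cancel₀ h0
    unfold jac
    linear_combination fderiv ℝ f p (EuclideanSpace.single 1 1) * hg
      - fderiv ℝ g p (EuclideanSpace.single 1 1) * hf
  simp [e0, e1]

lemma contDiffOn_fderiv_apply {U : Set Plane} (hU : IsOpen U) (hf : ContDiffOn ℝ ∞ f U)
    (v : Plane) : ContDiffOn ℝ ∞ (fun x => fderiv ℝ f x v) U :=
  (hf.fderiv_of_isOpen hU (m := ∞) (by simp)).clm_apply contDiffOn_const

lemma contDiffOn_jac {U : Set Plane} (hU : IsOpen U) (hf : ContDiffOn ℝ ∞ f U)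
    (hg : ContDiffOn ℝ ∞ g U) : ContDiffOn ℝ ∞ (jac f g) U :=
  ((contDiffOn_fderiv_apply hU hf _).mul (contDiffOn_fderiv_apply hU hg _)).sub
    ((contDiffOn_fderiv_apply hU hf _).mul (contDiffOn_fderiv_apply hU hg _))

lemma _root_.ContDiffOn.differentiableAt_of_isOpen {U : Set Plane} (hf : ContDiffOn ℝ ∞ f U)
    (hU : IsOpen U) (hp : p ∈ U) : DifferentiableAt ℝ f p :=
  (hf.contDiffAt (hU.mem_nhds hp)).differentiableAt (by simp)

end jac

/-- The exterior derivative of a vanishing `1`-form `∑ Aⱼ duⱼ` vanishes. -/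
lemma sum_jac_eq_zero {U : Set Plane} (hU : IsOpen U) {n : ℕ} {A u : Fin n → Plane → ℝ}
    (hA : ∀ j, ContDiffOn ℝ ∞ (A j) U) (hu : ∀ j, ContDiffOn ℝ ∞ (u j) U)
    (h : ∀ p ∈ U, ∑ j, A j p • fderiv ℝ (u j) p = 0) {p : Plane} (hp : p ∈ U) :
    ∑ j, jac (A j) (u j) p = 0 := by
  have key : ∀ v w : Plane, ∑ j, (A j p * fderiv ℝ (fun x => fderiv ℝ (u j) x v) p w
      + fderiv ℝ (u j) p v * fderiv ℝ (A j) p w) = 0 := by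
    intro v w
    have h1 : HasFDerivAt (fun x => ∑ j, A j x * fderiv ℝ (u j) x v)
        (∑ j, (A j p • fderiv ℝ (fun x => fderiv ℝ (u j) x v) p
          + fderiv ℝ (u j) p v • fderiv ℝ (A j) p)) p :=
      HasFDerivAt.fun_sum fun j _ =>
        (((hA j).differentiableAt_of_isOpen hU hp).hasFDerivAt).mul
          ((contDiffOn_fderiv_apply hU (hu j) v).differentiableAt_of_isOpen hU hp).hasFDerivAt
    have h2 : (fun x => ∑ j, A j x * fderiv ℝ (u j) x v) =ᶠ[nhds p] fun _ => 0 := by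
      refine Filter.eventuallyEq_of_mem (hU.mem_nhds hp) fun x hx => ?_
      have := congrArg (fun φ : Plane →L[ℝ] ℝ => φ v) (h x hx)
      simpa [sum_apply] using this
    have h3 := h1.fderiv
    rw [h2.fderiv_eq] at h3
    have := congrArg (fun φ : Plane →L[ℝ] ℝ => φ w) h3
    simpa [sum_apply] using this.symm
  have symm : ∀ j (v w : Plane), fderiv ℝ (fun x => fderiv ℝ (u j) x v) p w =
      fderiv ℝ (fun x => fderiv ℝ (u j) x w) p v := by
    intro j v w
    have hc := (hu j).contDiffAt (hU.mem_nhds hp)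
    have hd : DifferentiableAt ℝ (fderiv ℝ (u j)) p :=
      (hc.fderiv_right (m := ∞) (by simp)).differentiableAt (by simp)
    have e : ∀ v w : Plane, fderiv ℝ (fun x => fderiv ℝ (u j) x v) p w =
        fderiv ℝ (fderiv ℝ (u j)) p w v := by
      intro v w
      rw [fderiv_clm_apply hd (differentiableAt_const v)]
      simp
    rw [e, e]
    exact (hc.isSymmSndFDerivAt (by
      rw [minSmoothness_of_isRCLikeNormedField]; exact WithTop.coe_le_coe.2 (le_top : (2 : ℕ∞) ≤ ⊤))) w v
  -- In the difference of the two mixed derivatives of the form, the second derivatives of the `u j`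
  -- cancel by symmetry and only the Jacobians remain.
  have k1 := key (EuclideanSpace.single 1 1) (EuclideanSpace.single 0 1)
  have k2 := key (EuclideanSpace.single 0 1) (EuclideanSpace.single 1 1)
  rw [← sub_self (0 : ℝ)]
  nth_rewrite 1 [← k1]
  rw [← k2, ← Finset.sum_sub_distrib]
  refine Finset.sum_congr rfl fun j _ => ?_
  rw [symm j (EuclideanSpace.single 1 1)]
  unfold jac
  ring

end Plane

/-! ### The overdetermined system for the shear coefficients -/

namespace Plane

/-- An overdetermined system for two functions `a`, `b` of the coordinates `q`, `r`, without
nonvanishing solutions. -/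
theorem no_shear_solution {V : Set Plane} (hV : IsOpen V) {q r a b : Plane → ℝ} {w : ℝ}
    (hq : ContDiffOn ℝ ∞ q V) (hr : ContDiffOn ℝ ∞ r V) (ha : ContDiffOn ℝ ∞ a V)
    (hb : ContDiffOn ℝ ∞ b V)
    (hq0 : ∀ p ∈ V, q p ≠ 0) (hr0 : ∀ p ∈ V, r p ≠ 0) (ha0 : ∀ p ∈ V, a p ≠ 0)
    (hb0 : ∀ p ∈ V, b p ≠ 0)
    (hD0 : ∀ p ∈ V, w - q p + r p ≠ 0) (hD1 : ∀ p ∈ V, w - q p - r p ≠ 0)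
    (hD2 : ∀ p ∈ V, w + q p - r p ≠ 0) (hD3 : ∀ p ∈ V, w + q p + r p ≠ 0)
    (hW : ∀ p ∈ V, jac q r p ≠ 0)
    (h1 : ∀ p ∈ V, (w ^ 2 - q p ^ 2 - r p ^ 2) / 2 * jac a r p + q p * r p * jac a q p =
      2 * q p * a p * jac q r p)
    (h2 : ∀ p ∈ V, (w ^ 2 - q p ^ 2 - r p ^ 2) / 2 * jac b q p + q p * r p * jac b r p =
      -(2 * r p * b p * jac q r p))
    (hab : ∀ p ∈ V, a p * b p * (w - q p - r p) * (w + q p - r p) * (w + q p + r p) +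
      4 * a p * (w - q p - r p) * r p + 4 * b p * (w + q p + r p) * q p = 0) : V = ∅ := by
  by_contra hne
  obtain ⟨p₀, hp₀⟩ := Set.nonempty_iff_ne_empty.2 hne
  obtain ⟨E, hE⟩ : ∃ E : Plane → ℝ, E = fun p => (w ^ 2 - q p ^ 2 - r p ^ 2) * (1 / 2) := ⟨_, rfl⟩
  -- the reciprocals of `κ` and `κ'` satisfy linear equations
  obtain ⟨κ, hκ⟩ : ∃ κ : Plane → ℝ,
    κ = fun p => a p * ((w - q p - r p) * (w + q p - r p)) * r p := ⟨_, rfl⟩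
  obtain ⟨κ', hκ'⟩ : ∃ κ : Plane → ℝ,
    κ = fun p => b p * ((w + q p - r p) * (w + q p + r p)) * q p := ⟨_, rfl⟩
  have sE : ContDiffOn ℝ ∞ E V := by rw [hE]; fun_prop
  have sκ : ContDiffOn ℝ ∞ κ V := by rw [hκ]; fun_prop
  have sκ' : ContDiffOn ℝ ∞ κ' V := by rw [hκ']; fun_prop
  have κ0 : ∀ p ∈ V, κ p ≠ 0 := fun p hp => by
    simp only [hκ]
    exact mul_ne_zero (mul_ne_zero (ha0 p hp) (mul_ne_zero (hD1 p hp) (hD2 p hp))) (hr0 p hp)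
  have κ'0 : ∀ p ∈ V, κ' p ≠ 0 := fun p hp => by
    simp only [hκ']
    exact mul_ne_zero (mul_ne_zero (hb0 p hp) (mul_ne_zero (hD2 p hp) (hD3 p hp))) (hq0 p hp)
  obtain ⟨k, hk⟩ : ∃ k : Plane → ℝ, k = fun p => (κ p)⁻¹ := ⟨_, rfl⟩
  have sk : ContDiffOn ℝ ∞ k V := by rw [hk]; exact sκ.inv κ0
  have jE : ∀ p ∈ V, ∀ h, jac E h p = -(q p * jac q h p + r p * jac r h p) := by
    intro p hp h
    have dq := hq.differentiableAt_of_isOpen hV hp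
    have dr := hr.differentiableAt_of_isOpen hV hp
    rw [hE]
    simp (disch := fun_prop) only [jac_mul, jac_sub, jac_sq, jac_const]
    ring
  -- The factors multiplying `a` in `κ` form an integrating factor: they cancel the zeroth-order
  -- term of `h1`, making the equation homogeneous. The same holds for `κ'` and `h2`.
  have jκ : ∀ p ∈ V, E p * jac κ r p + q p * r p * jac κ q p = 0 := by
    intro p hp
    have dq := hq.differentiableAt_of_isOpen hV hp
    have dr := hr.differentiableAt_of_isOpen hV hp
    have da := ha.differentiableAt_of_isOpen hV hp
    have := h1 p hp
    rw [hκ, hE]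
    simp (disch := fun_prop) only [jac_mul, jac_sub, jac_add, jac_const, jac_self]
    rw [jac_swap (f := r) (g := q)]
    linear_combination ((w - q p - r p) * (w + q p - r p)) * r p * this
  have jκ' : ∀ p ∈ V, E p * jac κ' q p + q p * r p * jac κ' r p = 0 := by
    intro p hp
    have dq := hq.differentiableAt_of_isOpen hV hp
    have dr := hr.differentiableAt_of_isOpen hV hp
    have db := hb.differentiableAt_of_isOpen hV hp
    have := h2 p hp
    rw [hκ', hE]
    simp (disch := fun_prop) only [jac_mul, jac_sub, jac_add, jac_const, jac_self]
    rw [jac_swap (f := r) (g := q)]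
    linear_combination ((w + q p - r p) * (w + q p + r p)) * q p * this
  have jk1 : ∀ p ∈ V, E p * jac k r p + q p * r p * jac k q p = 0 := by
    intro p hp
    have dκ := sκ.differentiableAt_of_isOpen hV hp
    apply mul_left_cancel₀ (pow_ne_zero 2 (κ0 p hp))
    have e1 := jac_inv (h := r) dκ (κ0 p hp)
    have e2 := jac_inv (h := q) dκ (κ0 p hp)
    rw [hk]
    linear_combination E p * e1 + q p * r p * e2 - jκ p hp
  -- Division by `κ κ'` makes the quadratic relation linear in the reciprocals. This eliminates `b`:
  -- the single function `k` now satisfies two first-order equations.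
  have hkk : ∀ p ∈ V, (κ' p)⁻¹ = -(4 * (q p * r p))⁻¹ - k p := by
    intro p hp
    have := hab p hp
    rw [hk, hκ, hκ']
    have := hq0 p hp; have := hr0 p hp; have := ha0 p hp; have := hb0 p hp
    have := hD1 p hp; have := hD2 p hp; have := hD3 p hp
    field_simp
    linear_combination hab p hp
  have jk2 : ∀ p ∈ V, 4 * (q p * r p ^ 2) * (E p * jac k q p + q p * r p * jac k r p) =
      -(E p - r p ^ 2) * jac q r p := by
    intro p hp
    have dq := hq.differentiableAt_of_isOpen hV hp
    have dr := hr.differentiableAt_of_isOpen hV hp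
    have dκ' := sκ'.differentiableAt_of_isOpen hV hp
    have dk := sk.differentiableAt_of_isOpen hV hp
    have hne : 4 * (q p * r p) ≠ 0 := by
      have := hq0 p hp; have := hr0 p hp; positivity
    have dqr : DifferentiableAt ℝ (fun x => 4 * (q x * r x)) p := by fun_prop
    have dqr' : DifferentiableAt ℝ (fun x => (4 * (q x * r x))⁻¹) p := dqr.inv hne
    have e : ∀ h, jac (fun x => (κ' x)⁻¹) h p =
        -jac (fun x => (4 * (q x * r x))⁻¹) h p - jac k h p := by
      intro h
      rw [jac_congr hV hp hkk, jac_sub dqr'.fun_neg dk, jac_neg]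
    have e1 := jac_inv (h := r) dκ' (κ'0 p hp)
    have e2 := jac_inv (h := q) dκ' (κ'0 p hp)
    have e3 := jac_inv (h := r) dqr hne
    have e4 := jac_inv (h := q) dqr hne
    simp (disch := fun_prop) only [jac_mul, jac_const, jac_self] at e3 e4
    rw [jac_swap (f := r) (g := q)] at e4
    have e5 : E p * jac (fun x => (κ' x)⁻¹) q p + q p * r p * jac (fun x => (κ' x)⁻¹) r p = 0 := by
      apply mul_left_cancel₀ (pow_ne_zero 2 (κ'0 p hp))
      linear_combination E p * e2 + q p * r p * e1 - jκ' p hp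
    rw [e, e] at e5
    apply mul_left_cancel₀ hne
    linear_combination -(r p * (4 * (q p * r p)) ^ 2) * e5 - r p * E p * e4
      - r p * (q p * r p) * e3
  -- the differential of `k` is determined
  have hdk : ∀ p ∈ V, (-(4 * (q p * r p ^ 2) * (E p ^ 2 - q p ^ 2 * r p ^ 2))) • fderiv ℝ k p +
      ((E p - r p ^ 2) * (q p * r p)) • fderiv ℝ q p + ((E p - r p ^ 2) * E p) • fderiv ℝ r p
        = 0 := by
    intro p hp
    have e1 := jk1 p hp
    have e2 := jk2 p hp
    have e3 := jac_swap (f := r) (g := q) (p := p)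
    unfold jac at e1 e2 e3
    refine covector_eq_zero (hW p hp) ?_ ?_
    · simp only [add_apply, smul_apply, smul_eq_mul]
      linear_combination -E p * e2 + 4 * (q p * r p ^ 2) * (q p * r p) * e1
    · simp only [add_apply, smul_apply, smul_eq_mul]
      linear_combination -(4 * (q p * r p ^ 2)) * E p * e1 + (q p * r p) * e2
  -- The integrability condition `d(dk) = 0`. After the derivatives of `k` are substituted, it
  -- involves only `q` and `r`.
  have hH : ∀ p ∈ V, E p ^ 2 - E p * (q p ^ 2 + r p ^ 2) - q p ^ 2 * r p ^ 2 = 0 := by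
    intro p hp
    have dq := hq.differentiableAt_of_isOpen hV hp
    have dr := hr.differentiableAt_of_isOpen hV hp
    have dE := sE.differentiableAt_of_isOpen hV hp
    have := sum_jac_eq_zero hV
      (A := ![fun p => -(4 * (q p * r p ^ 2) * (E p ^ 2 - q p ^ 2 * r p ^ 2)),
        fun p => (E p - r p ^ 2) * (q p * r p), fun p => (E p - r p ^ 2) * E p])
      (u := ![k, q, r]) (fun j => by fin_cases j <;> (simp; fun_prop))
      (fun j => by fin_cases j <;> simpa) (fun p hp => by
        simpa [Fin.sum_univ_succ, add_assoc] using hdk p hp) hp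
    simp only [Fin.sum_univ_succ, Fin.sum_univ_zero, Matrix.cons_val_zero, Matrix.cons_val_succ,
      add_zero] at this
    simp (disch := fun_prop) only [jac_neg, jac_mul, jac_sub, jac_sq, jac_const, jac_self,
      jE p hp] at this
    have e1 := jk1 p hp
    have e2 := jk2 p hp
    have K1 : 4 * (q p * r p ^ 2) * (E p ^ 2 - q p ^ 2 * r p ^ 2) * jac k r p =
        (E p - r p ^ 2) * (q p * r p) * jac q r p := by
      linear_combination (4 * (q p * r p ^ 2)) * E p * e1 - (q p * r p) * e2
    have K2 : 4 * (q p * r p ^ 2) * (E p ^ 2 - q p ^ 2 * r p ^ 2) * jac k q p =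
        -((E p - r p ^ 2) * E p * jac q r p) := by
      linear_combination E p * e2 - 4 * (q p * r p ^ 2) * (q p * r p) * e1
    rw [jac_swap (f := q) (g := k), jac_swap (f := r) (g := k), jac_swap (f := r) (g := q)] at this
    -- The determinant of the linear system for `dk`; it splits into the four factors assumed
    -- nonzero.
    have hN : E p ^ 2 - q p ^ 2 * r p ^ 2 ≠ 0 := by
      have : E p ^ 2 - q p ^ 2 * r p ^ 2 = (w - q p - r p) * (w + q p + r p) *
          ((w - q p + r p) * (w + q p - r p)) / 4 := by rw [hE]; ring
      rw [this]
      exact div_ne_zero (mul_ne_zero (mul_ne_zero (hD1 p hp) (hD3 p hp))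
        (mul_ne_zero (hD0 p hp) (hD2 p hp))) (by norm_num)
    apply mul_left_cancel₀ (mul_ne_zero (mul_ne_zero four_ne_zero
      (mul_ne_zero (hq0 p hp) (pow_ne_zero 2 (hr0 p hp)))) (mul_ne_zero hN (hW p hp)))
    linear_combination (-q p * (4 * (q p * r p ^ 2) * (E p ^ 2 - q p ^ 2 * r p ^ 2))) * this
      + q p * (4 * r p ^ 2 * (E p ^ 2 - q p ^ 2 * r p ^ 2) + 4 * (q p * r p ^ 2) *
        (-2 * q p * E p - 2 * q p * r p ^ 2)) * K2
      + q p * (8 * q p * r p * (E p ^ 2 - q p ^ 2 * r p ^ 2) + 4 * (q p * r p ^ 2) *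
        (-2 * r p * E p - 2 * q p ^ 2 * r p)) * K1
  -- hence so is a relation between the coordinates, which is impossible
  have dq := hq.differentiableAt_of_isOpen hV hp₀
  have dr := hr.differentiableAt_of_isOpen hV hp₀
  have dE := sE.differentiableAt_of_isOpen hV hp₀
  have jH : ∀ h, jac (fun p => E p ^ 2 - E p * (q p ^ 2 + r p ^ 2) - q p ^ 2 * r p ^ 2) h p₀ = 0 :=
    fun h => by rw [jac_congr hV hp₀ hH, jac_const]
  have j1 := jH r
  have j2 := jH q
  simp (disch := fun_prop) only [jac_add, jac_mul, jac_sub, jac_sq, jac_self, jE p₀ hp₀] at j1 j2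
  rw [jac_swap (f := r) (g := q)] at j2
  -- As `dq ∧ dr ≠ 0`, both partial derivatives of the relation vanish. Together they give `E = 0`,
  -- and the relation is left with `q² r² = 0`.
  have f1 : 4 * E p₀ = q p₀ ^ 2 - r p₀ ^ 2 := by
    apply mul_left_cancel₀ (mul_ne_zero (hq0 p₀ hp₀) (hW p₀ hp₀))
    linear_combination -j1
  have f2 : 4 * E p₀ = r p₀ ^ 2 - q p₀ ^ 2 := by
    apply mul_left_cancel₀ (mul_ne_zero (hr0 p₀ hp₀) (hW p₀ hp₀))
    linear_combination j2
  have f3 : E p₀ = 0 := by linarith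
  have f4 := hH p₀ hp₀
  rw [f3] at f4
  have := hq0 p₀ hp₀
  have := hr0 p₀ hp₀
  have : 0 < q p₀ ^ 2 * r p₀ ^ 2 := by positivity
  linarith

end Plane

/-! ### Integral families over open sets of the plane -/

namespace IsIntegralPair
variable {x y X Y X' Y' : Fin 4 → ℝ} {τ : ℝ}

/-- The rotation of a side has exterior derivative four times the area form. -/
lemma polar_area (h : IsIntegralPair x y X Y X' Y' τ) (hD : ∀ i, triangleArea x y i ≠ 0)
    (i : Fin 4) : X (i + 1) * Y' i - X' (i + 1) * Y i - (Y (i + 1) * X' i - Y' (i + 1) * X i) =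
      -(2 * τ) := by
  obtain ⟨c, hc⟩ := h.exists_coeff hD
  obtain ⟨⟨h1, h2⟩, h3, h4⟩ := hc i
  have := h.area i
  simp only [sideRotation] at h1 h2 h3 h4
  -- The shear term contributes `cᵢ αᵢ ∧ αᵢ = 0`.
  linear_combination Y' i * h1 - Y i * h3 - X' i * h2 + X i * h4 - 2 * this

end IsIntegralPair

namespace Plane

/-- A smooth family of quadrilaterals with nonvanishing areas of triangles of consecutive vertices,
given by its coordinate functions, that is an integral manifold of the forms `θⁱ` on which no area
form vanishes. -/
structure IsIntegralFamily (U : Set Plane) (x y : Fin 4 → Plane → ℝ) : Prop where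
  isOpen : IsOpen U
  smooth_x : ∀ i, ContDiffOn ℝ ∞ (x i) U
  smooth_y : ∀ i, ContDiffOn ℝ ∞ (y i) U
  integral : ∀ p ∈ U, ∀ i, ∀ v, (y i p - y (i + 1) p) *
      (fderiv ℝ (x i) p v + fderiv ℝ (x (i + 1)) p v) =
    (x i p - x (i + 1) p) * (fderiv ℝ (y i) p v + fderiv ℝ (y (i + 1)) p v)
  jac_ne_zero : ∀ p ∈ U, ∀ i, jac (x i) (y i) p ≠ 0
  triangleArea_ne_zero : ∀ p ∈ U, ∀ i, triangleArea (x · p) (y · p) i ≠ 0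

namespace IsIntegralFamily
variable {U : Set Plane} {x y : Fin 4 → Plane → ℝ} {p : Plane}

lemma mono (h : IsIntegralFamily U x y) {V : Set Plane} (hV : IsOpen V) (hVU : V ⊆ U) :
    IsIntegralFamily V x y where
  isOpen := hV
  smooth_x i := (h.smooth_x i).mono hVU
  smooth_y i := (h.smooth_y i).mono hVU
  integral p hp := h.integral p (hVU hp)
  jac_ne_zero p hp := h.jac_ne_zero p (hVU hp)
  triangleArea_ne_zero p hp := h.triangleArea_ne_zero p (hVU hp)

/-- The exterior derivative of `θⁱ` is `dxᵢ₊₁ ∧ dyᵢ₊₁ - dxᵢ ∧ dyᵢ`, and it vanishes along with `θⁱ`.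
-/
lemma jac_succ (h : IsIntegralFamily U x y) (hp : p ∈ U) (i : Fin 4) :
    jac (x (i + 1)) (y (i + 1)) p = jac (x i) (y i) p := by
  have dx := fun i => (h.smooth_x i).differentiableAt_of_isOpen h.isOpen hp
  have dy := fun i => (h.smooth_y i).differentiableAt_of_isOpen h.isOpen hp
  have sx := h.smooth_x
  have sy := h.smooth_y
  have := sum_jac_eq_zero h.isOpen
    (A := ![fun p => y i p - y (i + 1) p, fun p => x (i + 1) p - x i p])
    (u := ![fun p => x i p + x (i + 1) p, fun p => y i p + y (i + 1) p])
    (fun j => by fin_cases j <;> (simp; fun_prop))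
    (fun j => by fin_cases j <;> (simp; fun_prop))
    (fun p hp => by
      ext v
      have dx := fun i => (h.smooth_x i).differentiableAt_of_isOpen h.isOpen hp
      have dy := fun i => (h.smooth_y i).differentiableAt_of_isOpen h.isOpen hp
      simp only [Fin.sum_univ_succ, Fin.sum_univ_zero, Matrix.cons_val_zero, Matrix.cons_val_succ,
        add_zero, fderiv_fun_add (dx _) (dx _), fderiv_fun_add (dy _) (dy _), add_apply, smul_apply,
        smul_eq_mul, zero_apply]
      linear_combination h.integral p hp i v) hp
  simp only [Fin.sum_univ_succ, Fin.sum_univ_zero, Matrix.cons_val_zero, Matrix.cons_val_succ,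
    add_zero] at this
  simp (disch := fun_prop) only [jac_sub] at this
  simp only [jac_swap (g := fun p => x i p + x (i + 1) p),
    jac_swap (g := fun p => y i p + y (i + 1) p)] at this
  simp (disch := fun_prop) only [jac_add] at this
  have e : ∀ i j, jac (y i) (x j) p = -jac (x j) (y i) p := fun i j => jac_swap
  simp only [e] at this
  linarith

lemma isIntegralPair (h : IsIntegralFamily U x y) (hp : p ∈ U) :
    IsIntegralPair (x · p) (y · p)
      (fun i => fderiv ℝ (x i) p (EuclideanSpace.single 0 1))
      (fun i => fderiv ℝ (y i) p (EuclideanSpace.single 0 1))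
      (fun i => fderiv ℝ (x i) p (EuclideanSpace.single 1 1))
      (fun i => fderiv ℝ (y i) p (EuclideanSpace.single 1 1)) (jac (x 0) (y 0) p) where
  left i := h.integral p hp i _
  right i := h.integral p hp i _
  area := by
    have h0 := h.jac_succ hp 0
    have h1 := h.jac_succ hp 1
    have h2 := h.jac_succ hp 2
    intro i
    change jac (x i) (y i) p = _
    fin_cases i
    · rfl
    · exact h0
    · exact h1.trans h0
    · exact h2.trans (h1.trans h0)
  area_ne_zero := h.jac_ne_zero p hp 0

/-- Twice the signed area of a triangle of consecutive vertices, as a function of the parameter. -/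
def area (x y : Fin 4 → Plane → ℝ) (i : Fin 4) (p : Plane) : ℝ := triangleArea (x · p) (y · p) i

lemma smooth_area (h : IsIntegralFamily U x y) (i : Fin 4) : ContDiffOn ℝ ∞ (area x y i) U := by
  have sx := h.smooth_x
  have sy := h.smooth_y
  unfold area triangleArea
  fun_prop

lemma fderiv_area (h : IsIntegralFamily U x y) (hp : p ∈ U) (i : Fin 4) (v : Plane) :
    fderiv ℝ (area x y i) p v = triangleAreaDeriv (x · p) (y · p) (fun i => fderiv ℝ (x i) p v)
      (fun i => fderiv ℝ (y i) p v) i := by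
  have dx := fun i => ((h.smooth_x i).differentiableAt_of_isOpen h.isOpen hp).hasFDerivAt
  have dy := fun i => ((h.smooth_y i).differentiableAt_of_isOpen h.isOpen hp).hasFDerivAt
  have : HasFDerivAt (area x y i) _ p :=
    (((dx (i + 1)).fun_sub (dx i)).fun_mul ((dy (i + 2)).fun_sub (dy i))).fun_sub
    (((dx (i + 2)).fun_sub (dx i)).fun_mul ((dy (i + 1)).fun_sub (dy i)))
  rw [this.fderiv]
  simp only [triangleAreaDeriv, add_apply, sub_apply, smul_apply, smul_eq_mul]
  ring

/-- The infinitesimal structure theorem for families. -/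
lemma infinitesimal_structure (h : IsIntegralFamily U x y) {w : ℝ} {q r : Plane → ℝ}
    (hq : q = fun p => area x y 2 p - area x y 1 p) (hr : r = fun p => area x y 0 p - area x y 1 p)
    (hp : p ∈ U) (hw : area x y 0 p + area x y 2 p = w) :
    ∃ a b : ℝ, a * b * (area x y 1 p * area x y 2 p * area x y 3 p) +
        a * area x y 1 p * r p + b * area x y 3 p * q p = 0 ∧
      fderiv ℝ (fun p => area x y 0 p + area x y 2 p) p = 0 ∧
      jac q r p = -(8 * w * jac (x 0) (y 0) p) ∧
      (8 * w * (x 0 p - x 1 p)) • fderiv ℝ (y 0) p - (8 * w * (y 0 p - y 1 p)) • fderiv ℝ (x 0) p =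
        (2 * (w + r p) - a * q p * r p) • fderiv ℝ q p
          - (2 * q p + a * ((w ^ 2 - q p ^ 2 - r p ^ 2) / 2)) • fderiv ℝ r p ∧
      (8 * w * (x 1 p - x 2 p)) • fderiv ℝ (y 1) p - (8 * w * (y 1 p - y 2 p)) • fderiv ℝ (x 1) p =
        (2 * r p + b * ((w ^ 2 - q p ^ 2 - r p ^ 2) / 2)) • fderiv ℝ q p
          + (2 * (w - q p) + b * q p * r p) • fderiv ℝ r p ∧
      (a = 0 → b = 0 → ∀ i, fderiv ℝ (x i) p + fderiv ℝ (x (i + 1)) p = 0 ∧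
        fderiv ℝ (y i) p + fderiv ℝ (y (i + 1)) p = 0) := by
  have dA := fun i => (h.smooth_area i).differentiableAt_of_isOpen h.isOpen hp
  have hext : ∀ {φ ψ : Plane →L[ℝ] ℝ},
      φ (EuclideanSpace.single 0 1) = ψ (EuclideanSpace.single 0 1) →
      φ (EuclideanSpace.single 1 1) = ψ (EuclideanSpace.single 1 1) → φ = ψ := by
    intro φ ψ h0 h1
    ext v
    rw [apply_eq_coords φ, apply_eq_coords ψ, h0, h1]
  obtain ⟨a, b, hab, ⟨hw1, hw2⟩, hW, ⟨h0, h0'⟩, ⟨h1, h1'⟩, hz⟩ :=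
    (h.isIntegralPair hp).infinitesimal_structure (h.triangleArea_ne_zero p hp)
      (D := fun i => area x y i p) (q := q p) (r := r p) (w := w) rfl rfl rfl hw.symm
      (by rw [hq]) (by rw [hr]) rfl
  simp only [← h.fderiv_area hp] at hw1 hw2 hW h0 h0' h1 h1'
  have eq : ∀ v, fderiv ℝ q p v = fderiv ℝ (area x y 2) p v - fderiv ℝ (area x y 1) p v := by
    intro v; rw [hq, fderiv_fun_sub (dA 2) (dA 1), sub_apply]
  have er : ∀ v, fderiv ℝ r p v = fderiv ℝ (area x y 0) p v - fderiv ℝ (area x y 1) p v := by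
    intro v; rw [hr, fderiv_fun_sub (dA 0) (dA 1), sub_apply]
  simp only [← eq, ← er] at hW h0 h0' h1 h1'
  refine ⟨a, b, hab, ?_, hW, ?_, ?_, fun ha hb i => ?_⟩
  · rw [fderiv_fun_add (dA 0) (dA 2)]
    exact hext (by simpa using hw1) (by simpa using hw2)
  · refine hext ?_ ?_ <;> simp only [sub_apply, smul_apply, smul_eq_mul]
    · rw [← h0]; simp only [sideRotation, zero_add]; ring
    · rw [← h0']; simp only [sideRotation, zero_add]; ring
  · have e : (1 + 1 : Fin 4) = 2 := rfl
    refine hext ?_ ?_ <;> simp only [add_apply, sub_apply, smul_apply, smul_eq_mul]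
    · rw [← h1]; simp only [sideRotation, e]; ring
    · rw [← h1']; simp only [sideRotation, e]; ring
  · obtain ⟨⟨k1, k2⟩, k3, k4⟩ := hz ha hb i
    exact ⟨hext k1 k3, hext k2 k4⟩

end IsIntegralFamily
end Plane

/-! ### Stationarity of the midpoints -/

namespace Plane.IsIntegralFamily
variable {U : Set Plane} {x y : Fin 4 → Plane → ℝ} {p : Plane}

/-- The exterior derivative of the rotation form: the vertex itself contributes `2τ`, and the mixed
terms another `2τ` by `polar_area`. This is the source of the differential equations for the shear
coefficients. -/
lemma jac_rotation (h : IsIntegralFamily U x y) (hp : p ∈ U) (i : Fin 4) :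
    jac (fun p => x i p - x (i + 1) p) (y i) p - jac (fun p => y i p - y (i + 1) p) (x i) p =
      4 * jac (x 0) (y 0) p := by
  have dx := fun i => (h.smooth_x i).differentiableAt_of_isOpen h.isOpen hp
  have dy := fun i => (h.smooth_y i).differentiableAt_of_isOpen h.isOpen hp
  rw [jac_sub (dx _) (dx _), jac_sub (dy _) (dy _), jac_swap (f := y i)]
  have h1 := (h.isIntegralPair hp).polar_area (h.triangleArea_ne_zero p hp) i
  have h2 : jac (x i) (y i) p = jac (x 0) (y 0) p := (h.isIntegralPair hp).area i
  change jac (x (i + 1)) (y i) p - jac (y (i + 1)) (x i) p = _ at h1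
  linear_combination 2 * h2 - h1

/-- Where the two differences of areas do not vanish, the midpoints are stationary. -/
lemma stationary_of_ne_zero (h : IsIntegralFamily U x y) {w : ℝ} (hw0 : w ≠ 0)
    (hw : ∀ p ∈ U, area x y 0 p + area x y 2 p = w) {q r : Plane → ℝ}
    (hq : q = fun p => area x y 2 p - area x y 1 p) (hr : r = fun p => area x y 0 p - area x y 1 p)
    (hp : p ∈ U) (hqp : q p ≠ 0) (hrp : r p ≠ 0) (i : Fin 4) :
    fderiv ℝ (x i) p + fderiv ℝ (x (i + 1)) p = 0 ∧
      fderiv ℝ (y i) p + fderiv ℝ (y (i + 1)) p = 0 := by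
  have sx := h.smooth_x
  have sy := h.smooth_y
  have sA := h.smooth_area
  have sq : ContDiffOn ℝ ∞ q U := by rw [hq]; fun_prop
  have sr : ContDiffOn ℝ ∞ r U := by rw [hr]; fun_prop
  have hU := h.isOpen
  -- the structure functions
  obtain ⟨a, ha⟩ : ∃ a : Plane → ℝ, a = fun p => (2 * (w + r p) + ((x 0 p - x 1 p) * jac (y 0) r p
    - (y 0 p - y 1 p) * jac (x 0) r p) / jac (x 0) (y 0) p) / (q p * r p) := ⟨_, rfl⟩
  obtain ⟨b, hb⟩ : ∃ b : Plane → ℝ, b = fun p => (((x 1 p - x 2 p) * jac (y 1) q p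
    - (y 1 p - y 2 p) * jac (x 1) q p) / jac (x 0) (y 0) p - 2 * (w - q p)) / (q p * r p) :=
    ⟨_, rfl⟩
  have str : ∀ p ∈ U, q p ≠ 0 → r p ≠ 0 →
      a p * b p * (area x y 1 p * area x y 2 p * area x y 3 p) +
        a p * area x y 1 p * r p + b p * area x y 3 p * q p = 0 ∧
      jac q r p = -(8 * w * jac (x 0) (y 0) p) ∧
      (8 * w * (x 0 p - x 1 p)) • fderiv ℝ (y 0) p - (8 * w * (y 0 p - y 1 p)) • fderiv ℝ (x 0) p =
        (2 * (w + r p) - a p * q p * r p) • fderiv ℝ q p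
          - (2 * q p + a p * ((w ^ 2 - q p ^ 2 - r p ^ 2) / 2)) • fderiv ℝ r p ∧
      (8 * w * (x 1 p - x 2 p)) • fderiv ℝ (y 1) p - (8 * w * (y 1 p - y 2 p)) • fderiv ℝ (x 1) p =
        (2 * r p + b p * ((w ^ 2 - q p ^ 2 - r p ^ 2) / 2)) • fderiv ℝ q p
          + (2 * (w - q p) + b p * q p * r p) • fderiv ℝ r p ∧
      (a p = 0 → b p = 0 → ∀ i, fderiv ℝ (x i) p + fderiv ℝ (x (i + 1)) p = 0 ∧
        fderiv ℝ (y i) p + fderiv ℝ (y (i + 1)) p = 0) := by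
    intro p hp hqp hrp
    obtain ⟨a', b', hab, -, hW, h0, h1, hz⟩ := h.infinitesimal_structure hq hr hp (hw p hp)
    have hτ := h.jac_ne_zero p hp 0
    have ev : ∀ {φ ψ : Plane →L[ℝ] ℝ}, φ = ψ → ∀ f : Plane → ℝ,
        φ (EuclideanSpace.single 0 1) * fderiv ℝ f p (EuclideanSpace.single 1 1) -
          φ (EuclideanSpace.single 1 1) * fderiv ℝ f p (EuclideanSpace.single 0 1) =
        ψ (EuclideanSpace.single 0 1) * fderiv ℝ f p (EuclideanSpace.single 1 1) -
          ψ (EuclideanSpace.single 1 1) * fderiv ℝ f p (EuclideanSpace.single 0 1) := by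
      rintro φ ψ rfl f; rfl
    have e0 := ev h0 r
    have e1 := ev h1 q
    simp only [add_apply, sub_apply, smul_apply, smul_eq_mul] at e0 e1
    -- The wedge of the first expansion with `dr` isolates the coefficient of `dq` and hence
    -- determines `a'`; the wedge of the second with `dq` determines `b'`. The pointwise
    -- coefficients are thus given by explicit smooth formulas.
    have ea : a' = a p := by
      simp only [ha]
      rw [eq_div_iff (mul_ne_zero hqp hrp), ← sub_eq_iff_eq_add', eq_div_iff hτ]
      apply mul_left_cancel₀ (mul_ne_zero (by norm_num : (8 : ℝ) ≠ 0) hw0)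
      unfold jac at hW ⊢
      linear_combination -e0 - (2 * (w + r p) - a' * q p * r p) * hW
    have eb : b' = b p := by
      simp only [hb]
      rw [eq_div_iff (mul_ne_zero hqp hrp), eq_sub_iff_add_eq, eq_div_iff hτ]
      apply mul_left_cancel₀ (mul_ne_zero (by norm_num : (8 : ℝ) ≠ 0) hw0)
      unfold jac at hW ⊢
      linear_combination -e1 + (2 * (w - q p) + b' * q p * r p) * hW
    rw [ea] at hab h0 hz
    rw [eb] at hab h1 hz
    exact ⟨hab, hW, h0, h1, hz⟩
  obtain ⟨V, hVe⟩ : ∃ V, V = U ∩ (fun p => q p * r p) ⁻¹' {0}ᶜ := ⟨_, rfl⟩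
  have hV : IsOpen V := by
    rw [hVe]
    exact (sq.continuousOn.mul sr.continuousOn).isOpen_inter_preimage hU isOpen_compl_singleton
  have hVU : V ⊆ U := by rw [hVe]; exact Set.inter_subset_left
  have hVq : ∀ p ∈ V, q p ≠ 0 ∧ r p ≠ 0 := by
    rw [hVe]; rintro p ⟨-, hp⟩; simpa using hp
  have sqr : ∀ p ∈ V, q p * r p ≠ 0 := fun p hp => mul_ne_zero (hVq p hp).1 (hVq p hp).2
  have hτV : ∀ p ∈ V, jac (x 0) (y 0) p ≠ 0 := fun p hp => h.jac_ne_zero p (hVU hp) 0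
  have sqV := sq.mono hVU
  have srV := sr.mono hVU
  have sxV := fun i => (sx i).mono hVU
  have syV := fun i => (sy i).mono hVU
  have sxy := contDiffOn_jac hV (sxV 0) (syV 0)
  have saV : ContDiffOn ℝ ∞ a V := by
    have h1 := contDiffOn_jac hV (sxV 0) srV
    have h2 := contDiffOn_jac hV (syV 0) srV
    rw [ha]
    exact ((contDiffOn_const.mul (contDiffOn_const.add srV)).add
      (((((sxV 0).sub (sxV 1)).mul h2).sub (((syV 0).sub (syV 1)).mul h1)).div sxy hτV)).div
      (sqV.mul srV) sqr
  have sbV : ContDiffOn ℝ ∞ b V := by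
    have h1 := contDiffOn_jac hV (sxV 1) sqV
    have h2 := contDiffOn_jac hV (syV 1) sqV
    rw [hb]
    exact ((((((sxV 1).sub (sxV 2)).mul h2).sub (((syV 1).sub (syV 2)).mul h1)).div sxy hτV).sub
      (contDiffOn_const.mul (contDiffOn_const.sub sqV))).div (sqV.mul srV) sqr
  -- the areas in terms of `q`, `r`
  have area0 : ∀ p ∈ U, 2 * area x y 0 p = w - q p + r p := fun p hp => by
    rw [hq, hr, ← hw p hp]; ring
  have area1 : ∀ p ∈ U, 2 * area x y 1 p = w - q p - r p := fun p hp => by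
    rw [hq, hr, ← hw p hp]; ring
  have area2 : ∀ p ∈ U, 2 * area x y 2 p = w + q p - r p := fun p hp => by
    rw [hq, hr, ← hw p hp]; ring
  have area3 : ∀ p ∈ U, 2 * area x y 3 p = w + q p + r p := fun p hp => by
    rw [hq, hr, ← hw p hp, area, triangleArea_sum]; simp only [area]; ring
  have area_ne : ∀ p ∈ U, ∀ i, 2 * area x y i p ≠ 0 := fun p hp i =>
    mul_ne_zero two_ne_zero (h.triangleArea_ne_zero p hp i)
  -- the differential equations
  have pde1 : ∀ p ∈ V, (w ^ 2 - q p ^ 2 - r p ^ 2) / 2 * jac a r p + q p * r p * jac a q p =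
      2 * q p * a p * jac q r p := by
    intro p hp
    have dq := sqV.differentiableAt_of_isOpen hV hp
    have dr := srV.differentiableAt_of_isOpen hV hp
    have da := saV.differentiableAt_of_isOpen hV hp
    have dx := fun i => (sxV i).differentiableAt_of_isOpen hV hp
    have dy := fun i => (syV i).differentiableAt_of_isOpen hV hp
    have := sum_jac_eq_zero hV
      (A := ![fun p => 8 * w * (x 0 p - x 1 p), fun p => -(8 * w * (y 0 p - y 1 p)),
        fun p => -(2 * (w + r p) - a p * q p * r p),
        fun p => 2 * q p + a p * ((w ^ 2 - q p ^ 2 - r p ^ 2) * (1 / 2))])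
      (u := ![y 0, x 0, q, r]) (fun j => by fin_cases j <;> (simp; fun_prop))
      (fun j => by fin_cases j <;> [exact syV _; exact sxV _; exact sqV; exact srV]) (fun p hp => by
        have e := (str p (hVU hp) (hVq p hp).1 (hVq p hp).2).2.2.1
        ext v
        have e' := congrArg (fun φ : Plane →L[ℝ] ℝ => φ v) e
        simp only [sub_apply, smul_apply, smul_eq_mul] at e'
        simp only [Fin.sum_univ_succ, Fin.sum_univ_zero, Matrix.cons_val_zero,
          Matrix.cons_val_succ, add_zero, add_apply, smul_apply, smul_eq_mul, zero_apply]
        linear_combination e') hp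
    simp only [Fin.sum_univ_succ, Fin.sum_univ_zero, Matrix.cons_val_zero, Matrix.cons_val_succ,
      add_zero] at this
    -- The derivative of the left side is `8w · 4τ = -4 dq ∧ dr`, so `τ` drops out of the equation.
    have e1 := h.jac_rotation (hVU hp) 0
    simp only [zero_add] at e1
    have e2 := (str p (hVU hp) (hVq p hp).1 (hVq p hp).2).2.1
    simp (disch := fun_prop) only [jac_neg, jac_mul, jac_sub, jac_add, jac_sq, jac_const, jac_self]
      at this e1
    rw [jac_swap (f := r) (g := q)] at this
    linear_combination this - 8 * w * e1 - 4 * e2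
  have pde2 : ∀ p ∈ V, (w ^ 2 - q p ^ 2 - r p ^ 2) / 2 * jac b q p + q p * r p * jac b r p =
      -(2 * r p * b p * jac q r p) := by
    intro p hp
    have dq := sqV.differentiableAt_of_isOpen hV hp
    have dr := srV.differentiableAt_of_isOpen hV hp
    have db := sbV.differentiableAt_of_isOpen hV hp
    have dx := fun i => (sxV i).differentiableAt_of_isOpen hV hp
    have dy := fun i => (syV i).differentiableAt_of_isOpen hV hp
    have := sum_jac_eq_zero hV
      (A := ![fun p => 8 * w * (x 1 p - x 2 p), fun p => -(8 * w * (y 1 p - y 2 p)),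
        fun p => -(2 * r p + b p * ((w ^ 2 - q p ^ 2 - r p ^ 2) * (1 / 2))),
        fun p => -(2 * (w - q p) + b p * q p * r p)])
      (u := ![y 1, x 1, q, r]) (fun j => by fin_cases j <;> (simp; fun_prop))
      (fun j => by fin_cases j <;> [exact syV _; exact sxV _; exact sqV; exact srV]) (fun p hp => by
        have e := (str p (hVU hp) (hVq p hp).1 (hVq p hp).2).2.2.2.1
        ext v
        have e' := congrArg (fun φ : Plane →L[ℝ] ℝ => φ v) e
        simp only [add_apply, sub_apply, smul_apply, smul_eq_mul] at e'
        simp only [Fin.sum_univ_succ, Fin.sum_univ_zero, Matrix.cons_val_zero,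
          Matrix.cons_val_succ, add_zero, add_apply, smul_apply, smul_eq_mul, zero_apply]
        linear_combination e') hp
    simp only [Fin.sum_univ_succ, Fin.sum_univ_zero, Matrix.cons_val_zero, Matrix.cons_val_succ,
      add_zero] at this
    have e1 := h.jac_rotation (hVU hp) 1
    simp only [show (1 + 1 : Fin 4) = 2 from rfl] at e1
    have e2 := (str p (hVU hp) (hVq p hp).1 (hVq p hp).2).2.1
    simp (disch := fun_prop) only [jac_neg, jac_mul, jac_sub, jac_add, jac_sq, jac_const, jac_self]
      at this e1
    rw [jac_swap (f := r) (g := q)] at this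
    linear_combination -this + 8 * w * e1 + 4 * e2
  have hab : ∀ p ∈ V, a p * b p * (w - q p - r p) * (w + q p - r p) * (w + q p + r p) +
      4 * a p * (w - q p - r p) * r p + 4 * b p * (w + q p + r p) * q p = 0 := by
    intro p hp
    rw [← area1 p (hVU hp), ← area2 p (hVU hp), ← area3 p (hVU hp)]
    linear_combination 8 * (str p (hVU hp) (hVq p hp).1 (hVq p hp).2).1
  have hpV : p ∈ V := by rw [hVe]; exact ⟨hp, by simp [hqp, hrp]⟩
  have hpair : a p * b p = 0 := by
    by_contra hne
    have hS : IsOpen (V ∩ (fun p => a p * b p) ⁻¹' {0}ᶜ) :=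
      (saV.continuousOn.mul sbV.continuousOn).isOpen_inter_preimage hV isOpen_compl_singleton
    have sub : V ∩ (fun p => a p * b p) ⁻¹' {0}ᶜ ⊆ V := Set.inter_subset_left
    have hab0 : ∀ p ∈ V ∩ (fun p => a p * b p) ⁻¹' {0}ᶜ, a p ≠ 0 ∧ b p ≠ 0 := by
      rintro p ⟨-, hp⟩; simpa using hp
    have := no_shear_solution hS (sqV.mono sub) (srV.mono sub) (saV.mono sub) (sbV.mono sub)
      (fun p hp => (hVq p hp.1).1) (fun p hp => (hVq p hp.1).2) (fun p hp => (hab0 p hp).1)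
      (fun p hp => (hab0 p hp).2)
      (fun p hp => by rw [← area0 p (hVU hp.1)]; exact area_ne p (hVU hp.1) 0)
      (fun p hp => by rw [← area1 p (hVU hp.1)]; exact area_ne p (hVU hp.1) 1)
      (fun p hp => by rw [← area2 p (hVU hp.1)]; exact area_ne p (hVU hp.1) 2)
      (fun p hp => by rw [← area3 p (hVU hp.1)]; exact area_ne p (hVU hp.1) 3)
      (fun p hp => by
        rw [(str p (hVU hp.1) (hVq p hp.1).1 (hVq p hp.1).2).2.1]
        exact neg_ne_zero.2 (mul_ne_zero (mul_ne_zero (by norm_num) hw0) (hτV p hp.1)))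
      (fun p hp => pde1 p hp.1) (fun p hp => pde2 p hp.1) (fun p hp => hab p hp.1)
    exact Set.notMem_empty p (this ▸ ⟨hpV, hne⟩)
  have hab' := hab p hpV
  have n1 := area_ne p hp 1
  have n3 := area_ne p hp 3
  rw [area1 p hp] at n1
  rw [area3 p hp] at n3
  refine (str p hp hqp hrp).2.2.2.2 ?_ ?_ i
  -- If one of `a`, `b` vanishes, the quadratic relation forces the other to vanish, its factor
  -- being nonzero.
  · rcases mul_eq_zero.1 hpair with h0 | h0
    · exact h0
    · simpa [h0, n1, hrp] using hab'
  · rcases mul_eq_zero.1 hpair with h0 | h0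
    · simpa [h0, n3, hqp] using hab'
    · exact h0

end Plane.IsIntegralFamily

namespace Plane

lemma jac_eq_zero_of_eventually {f h : Plane → ℝ} {p : Plane} (hf : ∀ᶠ x in nhds p, f x = 0) :
    jac f h p = 0 := by
  obtain ⟨U, hU, hU', hp⟩ := eventually_nhds_iff.1 hf
  rw [jac_congr (g := fun _ => 0) hU' hp hU, jac_const]

namespace IsIntegralFamily
variable {U : Set Plane} {x y : Fin 4 → Plane → ℝ} {p : Plane}

/-- On an integral family of quadrilaterals of nonvanishing area, the midpoints are stationary. -/
theorem stationary (h : IsIntegralFamily U x y)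
    (hw : ∀ p ∈ U, area x y 0 p + area x y 2 p ≠ 0) (hp : p ∈ U) (i : Fin 4) :
    fderiv ℝ (x i) p + fderiv ℝ (x (i + 1)) p = 0 ∧
      fderiv ℝ (y i) p + fderiv ℝ (y (i + 1)) p = 0 := by
  -- A ball is connected, so the total area is constant on it.
  obtain ⟨ε, hε, hball⟩ := Metric.isOpen_iff.1 h.isOpen p hp
  have hB : IsOpen (Metric.ball p ε) := Metric.isOpen_ball
  have hpB : p ∈ Metric.ball p ε := Metric.mem_ball_self hε
  have h' := h.mono hB hball
  have hw' := fun p hp => hw p (hball hp)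
  clear hw hball hp h
  have sA := h'.smooth_area
  have hconst : ∀ p' ∈ Metric.ball p ε,
      area x y 0 p' + area x y 2 p' = area x y 0 p + area x y 2 p := by
    intro p' hp'
    refine hB.is_const_of_fderiv_eq_zero (𝕜 := ℝ) (f := fun p => area x y 0 p + area x y 2 p)
      (convex_ball p ε).isPreconnected ?_ ?_ hp' hpB
    · exact ((sA 0).add (sA 2)).differentiableOn (by simp)
    · intro v hv
      obtain ⟨-, -, -, h0, -⟩ := h'.infinitesimal_structure rfl rfl hv rfl
      exact h0
  obtain ⟨q, hq⟩ : ∃ q : Plane → ℝ, q = fun p => area x y 2 p - area x y 1 p := ⟨_, rfl⟩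
  obtain ⟨r, hr⟩ : ∃ r : Plane → ℝ, r = fun p => area x y 0 p - area x y 1 p := ⟨_, rfl⟩
  have cq : ContinuousOn q (Metric.ball p ε) := by rw [hq]; exact ((sA 2).sub (sA 1)).continuousOn
  have hJ : ∀ p' ∈ Metric.ball p ε, jac q r p' ≠ 0 := by
    intro p' hp'
    obtain ⟨-, -, -, -, h0, -⟩ := h'.infinitesimal_structure hq hr hp' (hconst p' hp')
    rw [h0]
    exact neg_ne_zero.2 (mul_ne_zero (mul_ne_zero (by norm_num) (hw' p hpB))
      (h'.jac_ne_zero p' hp' 0))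
  have main := fun p' (hp' : p' ∈ Metric.ball p ε) => h'.stationary_of_ne_zero (hw' p hpB) hconst
    hq hr hp'
  have dense : ∃ᶠ p' in nhds p, q p' ≠ 0 ∧ r p' ≠ 0 := by
    intro hev
    have hev' : ∀ᶠ p' in nhds p, p' ∈ Metric.ball p ε ∧ ∀ᶠ p'' in nhds p', ¬(q p'' ≠ 0 ∧ r p'' ≠ 0) :=
      Filter.Eventually.and (hB.mem_nhds hpB) (eventually_eventually_nhds.2 hev)
    -- If `qr` vanished near `p`, then `r` would vanish near any nearby point where `q ≠ 0`,
    -- contradicting `hJ` there. So `q` would vanish near `p`, contradicting `hJ` at `p`.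
    refine hJ p hpB (jac_eq_zero_of_eventually (hev'.mono ?_))
    rintro p' ⟨hp', hqr⟩
    by_contra hne
    refine hJ p' hp' ?_
    rw [jac_swap, jac_eq_zero_of_eventually, neg_zero]
    have := (cq.continuousAt (hB.mem_nhds hp')).eventually_ne hne
    filter_upwards [hqr, this] with p'' h1 h2
    by_contra h3
    exact h1 ⟨h2, h3⟩
  have close : ∀ f g : Plane → ℝ, ContDiffOn ℝ ∞ f (Metric.ball p ε) →
      ContDiffOn ℝ ∞ g (Metric.ball p ε) →
      (∀ p' ∈ Metric.ball p ε, q p' ≠ 0 → r p' ≠ 0 → fderiv ℝ f p' + fderiv ℝ g p' = 0) →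
      fderiv ℝ f p + fderiv ℝ g p = 0 := by
    intro f g sf sg hfg
    have cf := (sf.continuousOn_fderiv_of_isOpen hB (by simp)).continuousAt (hB.mem_nhds hpB)
    have cg := (sg.continuousOn_fderiv_of_isOpen hB (by simp)).continuousAt (hB.mem_nhds hpB)
    by_contra hne
    refine dense ?_
    filter_upwards [(cf.add cg).eventually_ne hne, hB.mem_nhds hpB] with p' h1 h2 h3
    exact h1 (hfg p' h2 h3.1 h3.2)
  exact ⟨close _ _ (h'.smooth_x _) (h'.smooth_x _) fun p' h1 h2 h3 => (main p' h1 h2 h3 i).1,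
    close _ _ (h'.smooth_y _) (h'.smooth_y _) fun p' h1 h2 h3 => (main p' h1 h2 h3 i).2⟩

end IsIntegralFamily
end Plane

/-! ### Convexity through orientations -/

namespace Quadrilateral

lemma cross_ne_zero {z : Quadrilateral} (hz : z.Nondegenerate) (i : Fin 4) :
    cross (z i) (z (i + 1)) (z (i + 2)) ≠ 0 := by
  have := hz.2 (i + 1)
  rw [add_sub_cancel_right, add_assoc, show (1 + 1 : Fin 4) = 2 from rfl] at this
  intro h
  apply this
  unfold cross at h
  linear_combination h

/-- A quadrilateral is nondegenerate and convex if and only if the triangles of consecutive vertices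
all have the same strict orientation. -/
lemma nondegenerate_and_isConvex_iff {z : Quadrilateral} : z.Nondegenerate ∧ z.IsConvex ↔
    (∀ i, 0 < cross (z i) (z (i + 1)) (z (i + 2))) ∨
      ∀ i, cross (z i) (z (i + 1)) (z (i + 2)) < 0 := by
  have e : ∀ i : Fin 4, i + 3 + 1 = i ∧ i + 3 + 2 = i + 1 := by decide
  have cyc : ∀ i : Fin 4, cross (z i) (z (i + 1)) (z (i + 3)) =
      cross (z (i + 3)) (z (i + 3 + 1)) (z (i + 3 + 2)) := by
    intro i
    rw [(e i).1, (e i).2]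
    unfold cross; ring
  constructor
  · rintro ⟨hz, hc⟩
    -- The two vertices off side `i` lie on the same side of its line, so the two triangles of
    -- consecutive vertices containing that side have the same orientation.
    have hs : ∀ i : Fin 4, (0 < cross (z i) (z (i + 1)) (z (i + 2)) ↔
        0 < cross (z (i + 3)) (z (i + 3 + 1)) (z (i + 3 + 2))) := by
      intro i
      have n1 := cross_ne_zero hz i
      have n2 := cross_ne_zero hz (i + 3)
      rcases hc i with h | h
      · have h1 := h (i + 2)
        have h2 := h (i + 3)
        rw [cyc] at h2
        exact ⟨fun _ => lt_of_le_of_ne h2 n2.symm, fun _ => lt_of_le_of_ne h1 n1.symm⟩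
      · have h1 := h (i + 2)
        have h2 := h (i + 3)
        rw [cyc] at h2
        exact ⟨fun h => absurd h h1.not_gt, fun h => absurd h h2.not_gt⟩
    by_cases h0 : 0 < cross (z 0) (z (0 + 1)) (z (0 + 2))
    · left
      have h3 := (hs 0).1 h0
      have h2 := (hs 3).1 h3
      have h1 := (hs 2).1 h2
      intro i
      fin_cases i
      exacts [h0, h1, h2, h3]
    · right
      have h3 := mt (hs 0).2 h0
      have h2 := mt (hs 3).2 h3
      have h1 := mt (hs 2).2 h2
      have key : ∀ i, ¬ 0 < cross (z i) (z (i + 1)) (z (i + 2)) := by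
        intro i
        fin_cases i
        exacts [h0, h1, h2, h3]
      exact fun i => lt_of_le_of_ne (not_lt.1 (key i)) (cross_ne_zero hz i)
  · intro h
    have hne : ∀ i, cross (z i) (z (i + 1)) (z (i + 2)) ≠ 0 :=
      fun i => h.elim (fun h => (h i).ne') fun h => (h i).ne
    refine ⟨⟨fun i j hij hzz => ?_, fun i hi => ?_⟩, fun i => ?_⟩
    · have : ∀ i j : Fin 4, i ≠ j → j = i + 1 ∨ j = i + 2 ∨ i = j + 1 := by decide
      rcases this i j hij with rfl | rfl | rfl
      · exact hne i (by simp [cross, hzz])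
      · exact hne i (by simp [cross, hzz])
      · exact hne j (by simp [cross, hzz])
    · have e' : ∀ i : Fin 4, i - 1 + 1 = i ∧ i - 1 + 2 = i + 1 := by decide
      apply hne (i - 1)
      rw [(e' i).1, (e' i).2]
      unfold cross
      linear_combination hi
    · have e' : ∀ i j : Fin 4, j = i ∨ j = i + 1 ∨ j = i + 2 ∨ j = i + 3 := by decide
      rcases h with h | h
      · left
        intro j
        rcases e' i j with rfl | rfl | rfl | rfl
        · simp [cross]
        · simp [cross]
        · exact (h i).le
        · rw [cyc]; exact (h _).le
      · right
        intro j
        rcases e' i j with rfl | rfl | rfl | rfl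
        · simp [cross]
        · simp [cross]
        · exact (h i).le
        · rw [cyc]; exact (h _).le

lemma side_midpoint_eq_iff {z w : Quadrilateral} {i : Fin 4} :
    midpoint ℝ (w i) (w (i + 1)) = midpoint ℝ (z i) (z (i + 1)) ↔
      w i + w (i + 1) = z i + z (i + 1) := by
  rw [midpoint_eq_smul_add, midpoint_eq_smul_add]
  exact smul_right_injective _ (by norm_num : (⅟2 : ℝ) ≠ 0) |>.eq_iff

end Quadrilateral

/-! ### From manifolds to charts and coordinates -/

section chart
variable {M : Type*} [TopologicalSpace M] [ChartedSpace (EuclideanSpace ℝ (Fin 2)) M]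
  [IsManifold (𝓡 2) ∞ M] {F : Type*} [NormedAddCommGroup F] [NormedSpace ℝ F] {f : M → F}

lemma contDiffOn_comp_extChartAt_symm (hf : ContMDiff (𝓡 2) 𝓘(ℝ, F) ∞ f) (p₀ : M) :
    ContDiffOn ℝ ∞ (f ∘ (extChartAt (𝓡 2) p₀).symm) (extChartAt (𝓡 2) p₀).target :=
  (hf.comp_contMDiffOn (contMDiffOn_extChartAt_symm p₀)).contDiffOn

/-- The derivative of a map in a chart is its manifold derivative, up to an isomorphism of the
tangent spaces. -/
lemma exists_fderiv_comp_extChartAt_symm (hf : ContMDiff (𝓡 2) 𝓘(ℝ, F) ∞ f) (p₀ : M) {u : Plane}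
    (hu : u ∈ (extChartAt (𝓡 2) p₀).target) :
    ∃ A : Plane ≃L[ℝ] TangentSpace (𝓡 2) ((extChartAt (𝓡 2) p₀).symm u),
      ∀ v, fderiv ℝ (f ∘ (extChartAt (𝓡 2) p₀).symm) u v =
        mfderiv (𝓡 2) 𝓘(ℝ, F) f ((extChartAt (𝓡 2) p₀).symm u) (A v) := by
  have hinv := isInvertible_mfderivWithin_extChartAt_symm (I := 𝓡 2) hu
  rw [ModelWithCorners.Boundaryless.range_eq_univ, mfderivWithin_univ] at hinv
  obtain ⟨A, hA⟩ := hinv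
  refine ⟨A, fun v => ?_⟩
  have hd : MDifferentiableAt 𝓘(ℝ, Plane) (𝓡 2) (extChartAt (𝓡 2) p₀).symm u :=
    ((contMDiffOn_extChartAt_symm (n := ∞) p₀).contMDiffAt
      ((isOpen_extChartAt_target p₀).mem_nhds hu)).mdifferentiableAt (by simp)
  have hfd := (hf ((extChartAt (𝓡 2) p₀).symm u)).mdifferentiableAt (by simp)
  rw [← mfderiv_eq_fderiv, mfderiv_comp u hfd hd, ← hA]
  rfl

end chart

namespace Quadrilateral

/-- The coordinate functions of a family of quadrilaterals. -/
def coordX (g : Plane → Quadrilateral) (i : Fin 4) (u : Plane) : ℝ := (g u i).1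

/-- The coordinate functions of a family of quadrilaterals. -/
def coordY (g : Plane → Quadrilateral) (i : Fin 4) (u : Plane) : ℝ := (g u i).2

lemma fderiv_coordX {g : Plane → Quadrilateral} {u : Plane} (hg : DifferentiableAt ℝ g u)
    (i : Fin 4) (v : Plane) : fderiv ℝ (coordX g i) u v = (fderiv ℝ g u v i).1 := by
  have : HasFDerivAt (coordX g i) ((dx i).comp (fderiv ℝ g u)) u :=
    (dx i).hasFDerivAt.comp u hg.hasFDerivAt
  rw [this.fderiv]; rfl

lemma fderiv_coordY {g : Plane → Quadrilateral} {u : Plane} (hg : DifferentiableAt ℝ g u)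
    (i : Fin 4) (v : Plane) : fderiv ℝ (coordY g i) u v = (fderiv ℝ g u v i).2 := by
  have : HasFDerivAt (coordY g i) ((dy i).comp (fderiv ℝ g u)) u :=
    (dy i).hasFDerivAt.comp u hg.hasFDerivAt
  rw [this.fderiv]; rfl

lemma theta_apply (i : Fin 4) (z v : Quadrilateral) : theta i z v =
    1 / 2 * ((z i).2 - (z (i + 1)).2) * ((v i).1 + (v (i + 1)).1) -
      1 / 2 * ((z i).1 - (z (i + 1)).1) * ((v i).2 + (v (i + 1)).2) := rfl

lemma areaForm_fderiv {g : Plane → Quadrilateral} {u : Plane} (hg : DifferentiableAt ℝ g u)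
    (i : Fin 4) (v w : Plane) : areaForm i (fderiv ℝ g u v) (fderiv ℝ g u w) =
      (v 0 * w 1 - v 1 * w 0) * Plane.jac (coordX g i) (coordY g i) u := by
  have : areaForm i (fderiv ℝ g u v) (fderiv ℝ g u w) =
    fderiv ℝ (coordX g i) u v * fderiv ℝ (coordY g i) u w
      - fderiv ℝ (coordX g i) u w * fderiv ℝ (coordY g i) u v := by
    rw [fderiv_coordX hg, fderiv_coordY hg, fderiv_coordX hg, fderiv_coordY hg]; rfl
  rw [this, Plane.apply_eq_coords (fderiv ℝ (coordX g i) u) v,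
    Plane.apply_eq_coords (fderiv ℝ (coordX g i) u) w,
    Plane.apply_eq_coords (fderiv ℝ (coordY g i) u) v,
    Plane.apply_eq_coords (fderiv ℝ (coordY g i) u) w, Plane.jac]
  ring

lemma continuous_cross (i j : Fin 4) :
    Continuous fun w : Quadrilateral => cross (w i) (w (i + 1)) (w j) := by
  unfold cross; fun_prop

/-- Together the two conditions amount to strict inequalities. With `isClosed_isConvex`, convexity
is open and closed along a manifold of nondegenerate quadrilaterals. -/
lemma isOpen_nondegenerate_isConvex :
    IsOpen {w : Quadrilateral | w.Nondegenerate ∧ w.IsConvex} := by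
  simp only [nondegenerate_and_isConvex_iff, Set.ofPred_or, Set.ofPred_forall]
  exact (isOpen_iInter_of_finite fun i => isOpen_lt continuous_const (continuous_cross i _)).union
    (isOpen_iInter_of_finite fun i => isOpen_lt (continuous_cross i _) continuous_const)

lemma isClosed_isConvex : IsClosed {w : Quadrilateral | w.IsConvex} := by
  simp only [IsConvex, Set.ofPred_or, Set.ofPred_forall]
  exact isClosed_iInter fun i =>
    (isClosed_iInter fun j => isClosed_le continuous_const (continuous_cross i j)).union
      (isClosed_iInter fun j => isClosed_le (continuous_cross i j) continuous_const)

end Quadrilateral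

open Quadrilateral

/-! ### Integral manifolds through a convex quadrilateral -/

namespace IsNondegenerateIntegralManifold
variable {M : Type*} [TopologicalSpace M] [ChartedSpace (EuclideanSpace ℝ (Fin 2)) M]
  [IsManifold (𝓡 2) ∞ M] {f : M → Quadrilateral}

lemma isIntegralFamily (hf : IsNondegenerateIntegralManifold f) (p₀ : M) :
    Plane.IsIntegralFamily (extChartAt (𝓡 2) p₀).target
      (coordX (f ∘ (extChartAt (𝓡 2) p₀).symm)) (coordY (f ∘ (extChartAt (𝓡 2) p₀).symm)) := by
  have hc := contDiffOn_comp_extChartAt_symm hf.contMDiff p₀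
  have hU : IsOpen (extChartAt (𝓡 2) p₀).target := isOpen_extChartAt_target p₀
  have hd : ∀ u ∈ (extChartAt (𝓡 2) p₀).target,
      DifferentiableAt ℝ (f ∘ (extChartAt (𝓡 2) p₀).symm) u := fun u hu =>
    (hc.contDiffAt (hU.mem_nhds hu)).differentiableAt (by simp)
  refine ⟨hU, fun i => (dx i).contDiff.comp_contDiffOn hc,
    fun i => (dy i).contDiff.comp_contDiffOn hc, fun u hu i v => ?_, fun u hu i h0 => ?_,
    fun u hu i => cross_ne_zero (hf.nondegenerate _) i⟩
  · obtain ⟨A, hA⟩ := exists_fderiv_comp_extChartAt_symm hf.contMDiff p₀ hu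
    have := hf.integral _ i (A v)
    rw [← hA, theta_apply] at this
    rw [fderiv_coordX (hd u hu), fderiv_coordX (hd u hu), fderiv_coordY (hd u hu),
      fderiv_coordY (hd u hu)]
    simp only [coordX, coordY, Function.comp_apply] at this ⊢
    linear_combination 2 * this
  · obtain ⟨A, hA⟩ := exists_fderiv_comp_extChartAt_symm hf.contMDiff p₀ hu
    obtain ⟨v, w, hvw⟩ := hf.areaForm_ne_zero ((extChartAt (𝓡 2) p₀).symm u) i
    apply hvw
    obtain ⟨v', rfl⟩ := A.surjective v
    obtain ⟨w', rfl⟩ := A.surjective w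
    rw [← hA, ← hA, areaForm_fderiv (hd u hu), h0, mul_zero]

/-- Near a convex quadrilateral, the midpoints of an integral manifold are constant. -/
lemma eventually_midpoints_eq (hf : IsNondegenerateIntegralManifold f) {p₀ : M}
    (hp₀ : (f p₀).IsConvex) :
    ∀ᶠ p in nhds p₀, (f p).IsConvex ∧ ∀ i, f p i + f p (i + 1) = f p₀ i + f p₀ (i + 1) := by
  obtain ⟨g, hg⟩ : ∃ g, g = f ∘ (extChartAt (𝓡 2) p₀).symm := ⟨_, rfl⟩
  have hfam := hf.isIntegralFamily p₀
  have hc := contDiffOn_comp_extChartAt_symm hf.contMDiff p₀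
  rw [← hg] at hfam hc
  have hU' : IsOpen ((extChartAt (𝓡 2) p₀).target ∩ g ⁻¹' {w | w.Nondegenerate ∧ w.IsConvex}) :=
    hc.continuousOn.isOpen_inter_preimage (isOpen_extChartAt_target p₀)
      isOpen_nondegenerate_isConvex
  have hp : extChartAt (𝓡 2) p₀ p₀ ∈
      (extChartAt (𝓡 2) p₀).target ∩ g ⁻¹' {w | w.Nondegenerate ∧ w.IsConvex} := by
    refine ⟨mem_extChartAt_target p₀, ?_⟩
    rw [Set.mem_preimage, hg, Function.comp_apply, extChartAt_to_inv]
    exact ⟨hf.nondegenerate p₀, hp₀⟩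
  obtain ⟨ε, hε, hball⟩ := Metric.isOpen_iff.1 hU' _ hp
  have hfam' := hfam.mono Metric.isOpen_ball (hball.trans Set.inter_subset_left)
  -- Convexity enters here: the two triangles have the same orientation, so their signed areas
  -- cannot cancel.
  have harea : ∀ u ∈ Metric.ball (extChartAt (𝓡 2) p₀ p₀) ε,
      Plane.IsIntegralFamily.area (coordX g) (coordY g) 0 u +
        Plane.IsIntegralFamily.area (coordX g) (coordY g) 2 u ≠ 0 := by
    intro u hu
    rcases nondegenerate_and_isConvex_iff.1 (hball hu).2 with h | h
    · exact (add_pos (h 0) (h 2)).ne'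
    · exact (add_neg (h 0) (h 2)).ne
  have hst := fun u hu i => hfam'.stationary harea (p := u) hu i
  have hconst : ∀ u ∈ Metric.ball (extChartAt (𝓡 2) p₀ p₀) ε, ∀ i,
      g u i + g u (i + 1) =
        g (extChartAt (𝓡 2) p₀ p₀) i + g (extChartAt (𝓡 2) p₀ p₀) (i + 1) := by
    intro u hu i
    have key : ∀ F : Fin 4 → Plane → ℝ,
        (∀ i, ContDiffOn ℝ ∞ (F i) (Metric.ball (extChartAt (𝓡 2) p₀ p₀) ε)) →
        (∀ u ∈ Metric.ball (extChartAt (𝓡 2) p₀ p₀) ε,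
          fderiv ℝ (F i) u + fderiv ℝ (F (i + 1)) u = 0) →
        F i u + F (i + 1) u =
          F i (extChartAt (𝓡 2) p₀ p₀) + F (i + 1) (extChartAt (𝓡 2) p₀ p₀) := by
      intro F hF hF'
      refine Metric.isOpen_ball.is_const_of_fderiv_eq_zero (𝕜 := ℝ)
        (f := fun u => F i u + F (i + 1) u) (convex_ball _ ε).isPreconnected
        (((hF i).add (hF (i + 1))).differentiableOn (by simp)) (fun v hv => ?_) hu
        (Metric.mem_ball_self hε)
      rw [fderiv_fun_add ((hF i).differentiableAt_of_isOpen Metric.isOpen_ball hv)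
        ((hF (i + 1)).differentiableAt_of_isOpen Metric.isOpen_ball hv)]
      exact hF' v hv
    exact Prod.ext (key (coordX g) hfam'.smooth_x fun u hu => (hst u hu i).1)
      (key (coordY g) hfam'.smooth_y fun u hu => (hst u hu i).2)
  have hev : ∀ᶠ p in nhds p₀, extChartAt (𝓡 2) p₀ p ∈ Metric.ball (extChartAt (𝓡 2) p₀ p₀) ε :=
    (continuousAt_extChartAt p₀) (Metric.ball_mem_nhds _ hε)
  filter_upwards [hev, extChartAt_source_mem_nhds (I := 𝓡 2) p₀] with p h1 h2
  have h3 := hconst _ h1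
  have h4 := (hball h1).2.2
  simp only [hg, Function.comp_apply, (extChartAt (𝓡 2) p₀).left_inv h2, extChartAt_to_inv]
    at h3 h4
  exact ⟨h4, h3⟩

/-- The motion of a vertex on an integral manifold is an open map. -/
lemma isOpenMap_vertex (hf : IsNondegenerateIntegralManifold f) (i : Fin 4) :
    IsOpenMap fun p => f p i := by
  refine isOpenMap_iff_nhds_le.2 fun p₀ => ?_
  obtain ⟨g, hg⟩ : ∃ g, g = f ∘ (extChartAt (𝓡 2) p₀).symm := ⟨_, rfl⟩
  have hfam := hf.isIntegralFamily p₀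
  have hc := contDiffOn_comp_extChartAt_symm hf.contMDiff p₀
  rw [← hg] at hfam hc
  have hu := mem_extChartAt_target (I := 𝓡 2) p₀
  have hca := hc.contDiffAt ((isOpen_extChartAt_target p₀).mem_nhds hu)
  have hd := hca.differentiableAt (by simp)
  have hs : HasStrictFDerivAt (fun u => g u i) ((ContinuousLinearMap.proj (R := ℝ) i).comp
      (fderiv ℝ g (extChartAt (𝓡 2) p₀ p₀))) (extChartAt (𝓡 2) p₀ p₀) :=
    (ContinuousLinearMap.proj (R := ℝ) (φ := fun _ : Fin 4 => ℝ × ℝ) i).hasStrictFDerivAt.comp _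
      (hca.hasStrictFDerivAt (by simp))
  have hJ := hfam.jac_ne_zero _ hu i
  have hsurj : ((ContinuousLinearMap.proj (R := ℝ) i).comp
      (fderiv ℝ g (extChartAt (𝓡 2) p₀ p₀))).range = ⊤ := by
    refine LinearMap.range_eq_top.2 fun ⟨s, t⟩ => ?_
    obtain ⟨X, hX⟩ : ∃ X, X = fderiv ℝ (coordX g i) (extChartAt (𝓡 2) p₀ p₀) := ⟨_, rfl⟩
    obtain ⟨Y, hY⟩ : ∃ Y, Y = fderiv ℝ (coordY g i) (extChartAt (𝓡 2) p₀ p₀) := ⟨_, rfl⟩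
    obtain ⟨J, hJe⟩ : ∃ J, J = X (EuclideanSpace.single 0 1) * Y (EuclideanSpace.single 1 1) -
      X (EuclideanSpace.single 1 1) * Y (EuclideanSpace.single 0 1) := ⟨_, rfl⟩
    unfold Plane.jac at hJ
    rw [← hX, ← hY, ← hJe] at hJ
    -- A preimage of `(s, t)` by Cramer's rule, the determinant being the nonzero area form.
    refine ⟨!₂[(s * Y (EuclideanSpace.single 1 1) - t * X (EuclideanSpace.single 1 1)) / J,
      (t * X (EuclideanSpace.single 0 1) - s * Y (EuclideanSpace.single 0 1)) / J], ?_⟩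
    refine Prod.ext ((fderiv_coordX hd i _).symm.trans ?_) ((fderiv_coordY hd i _).symm.trans ?_)
    · rw [← hX, Plane.apply_eq_coords X]
      simp only [Matrix.cons_val_zero, Matrix.cons_val_one]
      field_simp
      linear_combination -s * hJe
    · rw [← hY, Plane.apply_eq_coords Y]
      simp only [Matrix.cons_val_zero, Matrix.cons_val_one]
      field_simp
      linear_combination -t * hJe
  have hmap := hs.map_nhds_eq_of_surj hsurj
  have ht : Filter.map (extChartAt (𝓡 2) p₀).symm (nhds (extChartAt (𝓡 2) p₀ p₀)) ≤ nhds p₀ := by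
    have := continuousAt_extChartAt_symm (I := 𝓡 2) p₀
    rwa [ContinuousAt, extChartAt_to_inv] at this
  have e : g (extChartAt (𝓡 2) p₀ p₀) = f p₀ := by
    rw [hg, Function.comp_apply, extChartAt_to_inv]
  rw [e] at hmap
  rw [← hmap]
  calc Filter.map (fun u => g u i) (nhds (extChartAt (𝓡 2) p₀ p₀))
      = Filter.map (fun p => f p i)
        (Filter.map (extChartAt (𝓡 2) p₀).symm (nhds (extChartAt (𝓡 2) p₀ p₀))) := by
        rw [Filter.map_map, hg]; rfl
    _ ≤ _ := Filter.map_mono ht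

end IsNondegenerateIntegralManifold

namespace IsNondegenerateIntegralManifold
variable {M : Type*} [TopologicalSpace M] [ChartedSpace (EuclideanSpace ℝ (Fin 2)) M]
  [IsManifold (𝓡 2) ∞ M] {f : M → Quadrilateral}

/-- A connected integral manifold through a convex quadrilateral consists of convex quadrilaterals
with the same midpoints. -/
lemma range_subset_sameMidpoints [ConnectedSpace M] (hf : IsNondegenerateIntegralManifold f)
    {z : Quadrilateral} (hz : z.IsConvex) (hzf : z ∈ Set.range f) (p : M) :
    f p ∈ z.sameMidpoints := by
  have hclopen : IsClopen {p | f p ∈ z.sameMidpoints} := by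
    constructor
    · have : {p | f p ∈ z.sameMidpoints} = {p | (f p).IsConvex} ∩
          ⋂ i, {p | f p i + f p (i + 1) = z i + z (i + 1)} := by
        ext p
        simp only [sameMidpoints, Set.mem_ofPred_eq, hf.nondegenerate p, true_and, side_midpoint_eq_iff,
          Set.mem_inter_iff, Set.mem_iInter]
      rw [this]
      have hc := hf.contMDiff.continuous
      refine (isClosed_isConvex.preimage hc).inter (isClosed_iInter fun i =>
        isClosed_eq ?_ continuous_const)
      exact ((continuous_apply i).comp hc).add ((continuous_apply (i + 1)).comp hc)
    · refine isOpen_iff_mem_nhds.2 fun p hp => ?_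
      filter_upwards [hf.eventually_midpoints_eq hp.2.1] with p' hp'
      exact ⟨hf.nondegenerate p', hp'.1,
        fun i => side_midpoint_eq_iff.2 ((hp'.2 i).trans (side_midpoint_eq_iff.1 (hp.2.2 i)))⟩
  obtain ⟨p₀, rfl⟩ := hzf
  have := hclopen.eq_univ ⟨p₀, hf.nondegenerate p₀, hz, fun i => rfl⟩
  have hp : p ∈ {p | f p ∈ (f p₀).sameMidpoints} := by rw [this]; exact Set.mem_univ p
  exact hp

end IsNondegenerateIntegralManifold

/-! ### The integral manifold `F_z` -/

namespace Quadrilateral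

/-- Quadrilaterals with the same midpoints are determined by one vertex. -/
lemma eq_of_midpoints_eq {w w' : Quadrilateral} (h : ∀ i, w i + w (i + 1) = w' i + w' (i + 1))
    (h0 : w 0 = w' 0) : w = w' := by
  have step : ∀ i, w i = w' i → w (i + 1) = w' (i + 1) := fun i hi => by
    have := h i
    rwa [hi, add_right_inj] at this
  have h1 := step 0 h0
  have h2 := step 1 h1
  have h3 := step 2 h2
  funext i
  fin_cases i
  exacts [h0, h1, h2, h3]

/-- The linear map moving the vertices alternately by `t` and `-t`. -/
noncomputable def alternating : Plane →L[ℝ] Quadrilateral :=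
  ContinuousLinearMap.pi fun i => (![1, -1, 1, -1] i : ℝ) •
    (EuclideanSpace.proj 0).prod (EuclideanSpace.proj 1)

lemma alternating_apply (t : Plane) (i : Fin 4) :
    alternating t i = (![1, -1, 1, -1] i * t 0, ![1, -1, 1, -1] i * t 1) := rfl

lemma alternating_succ (t : Plane) (i : Fin 4) : alternating t (i + 1) = -alternating t i := by
  simp only [alternating_apply]
  fin_cases i <;> simp

/-- The parameters of the convex quadrilaterals with the same midpoints as `z`. -/
def parameters (z : Quadrilateral) : Set Plane :=
  {t | (z + alternating t).Nondegenerate ∧ (z + alternating t).IsConvex}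

lemma isOpen_parameters (z : Quadrilateral) : IsOpen z.parameters :=
  isOpen_nondegenerate_isConvex.preimage (continuous_const.add alternating.continuous)

/-- The vertices `i` and `i + 2` receive the same displacement, so one of the two vectors in the
determinant does not depend on the parameter, and the determinant is affine in it. -/
lemma cross_add_alternating_convex (z : Quadrilateral) (s t : Plane) {a b : ℝ} (hab : a + b = 1)
    (i : Fin 4) :
    cross ((z + alternating (a • s + b • t)) i) ((z + alternating (a • s + b • t)) (i + 1))
      ((z + alternating (a • s + b • t)) (i + 2)) =
    a * cross ((z + alternating s) i) ((z + alternating s) (i + 1))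
      ((z + alternating s) (i + 2)) +
    b * cross ((z + alternating t) i) ((z + alternating t) (i + 1))
      ((z + alternating t) (i + 2)) := by
  obtain rfl : b = 1 - a := by linarith
  have e : ∀ t, alternating t (i + 2) = alternating t i := fun t => by
    rw [show i + 2 = i + 1 + 1 by rw [add_assoc]; rfl, alternating_succ, alternating_succ, neg_neg]
  simp only [Pi.add_apply, e, alternating_succ, map_add, map_smul, Pi.smul_apply, cross,
    Prod.fst_add, Prod.snd_add, Prod.fst_neg, Prod.snd_neg, Prod.smul_fst, Prod.smul_snd,
    smul_eq_mul]
  ring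

/-- The total signed area is half the determinant of the diagonals, which the alternating motion
leaves fixed. In `convex_parameters` this excludes opposite orientations. -/
lemma area_add_alternating (z : Quadrilateral) (t : Plane) :
    cross ((z + alternating t) 0) ((z + alternating t) 1) ((z + alternating t) 2) +
      cross ((z + alternating t) 2) ((z + alternating t) 3) ((z + alternating t) 0) =
    cross (z 0) (z 1) (z 2) + cross (z 2) (z 3) (z 0) := by
  simp [alternating_apply, cross]
  ring

lemma convex_parameters (z : Quadrilateral) : Convex ℝ z.parameters := by
  intro s hs t ht a b ha hb hab
  simp only [parameters, Set.mem_ofPred_eq, nondegenerate_and_isConvex_iff] at hs ht ⊢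
  have hab' : 0 < a ∨ 0 < b := by
    by_contra! h
    linarith
  have es := area_add_alternating z s
  have et := area_add_alternating z t
  rcases hs with hs | hs <;> rcases ht with ht | ht
  · left
    intro i
    rw [cross_add_alternating_convex z s t hab]
    rcases hab' with h | h
    · exact add_pos_of_pos_of_nonneg (mul_pos h (hs i)) (mul_nonneg hb (ht i).le)
    · exact add_pos_of_nonneg_of_pos (mul_nonneg ha (hs i).le) (mul_pos h (ht i))
  · have h1 := add_pos (hs 0) (hs 2)
    have h2 := add_neg (ht 0) (ht 2)
    exact absurd (es.trans et.symm) (h2.trans h1).ne'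
  · have h1 := add_neg (hs 0) (hs 2)
    have h2 := add_pos (ht 0) (ht 2)
    exact absurd (es.trans et.symm) (h1.trans h2).ne
  · right
    intro i
    rw [cross_add_alternating_convex z s t hab]
    rcases hab' with h | h
    · exact add_neg_of_neg_of_nonpos (mul_neg_of_pos_of_neg h (hs i))
        (mul_nonpos_of_nonneg_of_nonpos hb (ht i).le)
    · exact add_neg_of_nonpos_of_neg (mul_nonpos_of_nonneg_of_nonpos ha (hs i).le)
        (mul_neg_of_pos_of_neg h (ht i))

lemma image_parameters (z : Quadrilateral) :
    (fun t => z + alternating t) '' z.parameters = z.sameMidpoints := by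
  have hmid : ∀ t i, (z + alternating t) i + (z + alternating t) (i + 1) = z i + z (i + 1) := by
    intro t i
    rw [Pi.add_apply, Pi.add_apply, alternating_succ]
    abel
  have hsub : ∀ t ∈ z.parameters, z + alternating t ∈ z.sameMidpoints := fun t ht =>
    ⟨ht.1, ht.2, fun i => side_midpoint_eq_iff.2 (hmid t i)⟩
  refine Set.Subset.antisymm (Set.image_subset_iff.2 hsub) fun w hw => ?_
  have key : w = z + alternating !₂[(w 0 - z 0).1, (w 0 - z 0).2] :=
    eq_of_midpoints_eq (fun i => (side_midpoint_eq_iff.1 (hw.2.2 i)).trans (hmid _ i).symm)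
      (by ext <;> simp [alternating_apply])
  refine ⟨_, ?_, key.symm⟩
  rw [parameters, Set.mem_ofPred_eq, ← key]
  exact ⟨hw.1, hw.2.1⟩

lemma isEmbedding_add_alternating (z : Quadrilateral) :
    Topology.IsEmbedding fun t => z + alternating t := by
  refine Function.LeftInverse.isEmbedding
    (f := fun w : Quadrilateral => (!₂[(w 0 - z 0).1, (w 0 - z 0).2] : Plane))
    (fun t => ?_) ?_ (continuous_const.add alternating.continuous)
  · ext i
    fin_cases i <;> simp [alternating_apply]
  · refine (PiLp.continuous_toLp 2 _).comp (continuous_pi fun i => ?_)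
    fin_cases i
    · exact continuous_fst.comp ((continuous_apply 0).sub continuous_const)
    · exact continuous_snd.comp ((continuous_apply 0).sub continuous_const)

/-- The convex quadrilaterals with the same midpoints as `z` form an integral manifold. -/
lemma isNondegenerateIntegralManifold_parameters (z : Quadrilateral) :
    IsNondegenerateIntegralManifold
      fun t : (⟨z.parameters, z.isOpen_parameters⟩ : TopologicalSpace.Opens Plane) =>
        z + alternating t.1 := by
  obtain ⟨T, hT⟩ : ∃ T : TopologicalSpace.Opens Plane, T = ⟨z.parameters, z.isOpen_parameters⟩ :=
    ⟨_, rfl⟩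
  rw [← hT]
  have hsm : ContDiff ℝ ∞ fun t : Plane => z + alternating t := contDiff_const.add alternating.contDiff
  have hf : ContMDiff (𝓡 2) 𝓘(ℝ, Quadrilateral) ∞ fun t : T => z + alternating t.1 :=
    hsm.contMDiff.comp contMDiff_subtype_val
  have hderiv : ∀ p : T, ∃ A : Plane ≃L[ℝ] TangentSpace (𝓡 2) p, ∀ v,
      alternating v = mfderiv (𝓡 2) 𝓘(ℝ, Quadrilateral) (fun t : T => z + alternating t.1) p (A v) := by
    intro p
    have main : ∀ u ∈ (extChartAt (𝓡 2) p).target,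
        ∃ A : Plane ≃L[ℝ] TangentSpace (𝓡 2) ((extChartAt (𝓡 2) p).symm u), ∀ v,
          alternating v = mfderiv (𝓡 2) 𝓘(ℝ, Quadrilateral) (fun t : T => z + alternating t.1)
            ((extChartAt (𝓡 2) p).symm u) (A v) := by
      intro u hu
      obtain ⟨A, hA⟩ := exists_fderiv_comp_extChartAt_symm hf p hu
      refine ⟨A, fun v => ?_⟩
      rw [← hA]
      -- The chart of an open subset of the plane is the inclusion, so the map in this chart is the
      -- affine map itself.
      have e : (fun t : T => z + alternating t.1) ∘ (extChartAt (𝓡 2) p).symm =ᶠ[nhds u]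
          fun t => z + alternating t := by
        refine Filter.eventuallyEq_of_mem ((isOpen_extChartAt_target p).mem_nhds hu) fun t ht => ?_
        have : ((extChartAt (𝓡 2) p).symm t).1 = t := (extChartAt (𝓡 2) p).right_inv ht
        simp only [Function.comp_apply, this]
      rw [e.fderiv_eq, fderiv_const_add, alternating.fderiv]
    have := main _ (mem_extChartAt_target p)
    rwa [extChartAt_to_inv] at this
  refine ⟨hf, fun p => ?_, fun p i v => ?_, fun p => ?_, fun p i => ?_⟩
  · obtain ⟨A, hA⟩ := hderiv p
    refine (injective_iff_map_eq_zero _).2 fun v hv => ?_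
    obtain ⟨v, rfl⟩ := A.surjective v
    rw [← hA] at hv
    have h0 : alternating v 0 = 0 := congrFun hv 0
    rw [alternating_apply] at h0
    have : v = 0 := by
      ext i
      fin_cases i
      · simpa using congrArg Prod.fst h0
      · simpa using congrArg Prod.snd h0
    rw [this, map_zero]
  · obtain ⟨A, hA⟩ := hderiv p
    obtain ⟨v, rfl⟩ := A.surjective v
    rw [← hA, theta_apply, alternating_succ]
    simp
  · have hp : p.1 ∈ z.parameters := by
      have h : ∀ t ∈ T, t ∈ z.parameters := by rw [hT]; exact fun t ht => ht
      exact h p.1 p.2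
    exact hp.1
  · obtain ⟨A, hA⟩ := hderiv p
    refine ⟨A (EuclideanSpace.single 0 1), A (EuclideanSpace.single 1 1), ?_⟩
    rw [← hA, ← hA]
    simp only [areaForm, dx, dy, ContinuousLinearMap.comp_apply, ContinuousLinearMap.proj_apply,
      alternating_apply]
    fin_cases i <;> simp

end Quadrilateral

/-! ### Proof of the theorem -/

theorem theorem2 (z : Quadrilateral) (hz : z.Nondegenerate) (hconv : z.IsConvex) :
    z ∈ z.sameMidpoints ∧
    (∃ (M : Type) (_ : TopologicalSpace M) (_ : ChartedSpace (EuclideanSpace ℝ (Fin 2)) M)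
      (_ : IsManifold (𝓡 2) ∞ M) (_ : T2Space M) (_ : SecondCountableTopology M)
      (_ : ConnectedSpace M) (f : M → Quadrilateral),
      IsNondegenerateIntegralManifold f ∧ Topology.IsEmbedding f ∧
        Set.range f = z.sameMidpoints) ∧
    ∀ (M : Type*) [TopologicalSpace M] [ChartedSpace (EuclideanSpace ℝ (Fin 2)) M]
      [IsManifold (𝓡 2) ∞ M] [ConnectedSpace M] (f : M → Quadrilateral),
      IsNondegenerateIntegralManifold f → z ∈ Set.range f →
        ∃ O : Set Quadrilateral, IsOpen O ∧ Set.range f = z.sameMidpoints ∩ O := by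
  refine ⟨⟨hz, hconv, fun i => rfl⟩, ?_, ?_⟩
  · have hconn : ConnectedSpace
        (⟨z.parameters, z.isOpen_parameters⟩ : TopologicalSpace.Opens Plane) := by
      refine Subtype.connectedSpace ⟨⟨0, ?_⟩, z.convex_parameters.isPreconnected⟩
      change (z + alternating 0).Nondegenerate ∧ (z + alternating 0).IsConvex
      rw [map_zero, add_zero]
      exact ⟨hz, hconv⟩
    refine ⟨(⟨z.parameters, z.isOpen_parameters⟩ : TopologicalSpace.Opens Plane), inferInstance,
      inferInstance, inferInstance, inferInstance, inferInstance, hconn, _,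
      z.isNondegenerateIntegralManifold_parameters,
      z.isEmbedding_add_alternating.comp Topology.IsEmbedding.subtypeVal, ?_⟩
    rw [← z.image_parameters, Set.image_eq_range]
    rfl
  · intro M _ _ _ _ f hf hzf
    have hmem := hf.range_subset_sameMidpoints hconv hzf
    -- Vertex 0 determines a point of `F_z`, so the image is cut out of `F_z` by the set of
    -- positions that vertex 0 takes, which is open by `isOpenMap_vertex`.
    refine ⟨{w | w 0 ∈ Set.range fun p => f p 0},
      (hf.isOpenMap_vertex 0).isOpen_range.preimage (continuous_apply 0), ?_⟩
    refine Set.Subset.antisymm ?_ ?_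
    · rintro _ ⟨p, rfl⟩
      exact ⟨hmem p, p, rfl⟩
    · rintro w ⟨hw, p, hp⟩
      exact ⟨p, eq_of_midpoints_eq (fun i => (side_midpoint_eq_iff.1 ((hmem p).2.2 i)).trans
        (side_midpoint_eq_iff.1 (hw.2.2 i)).symm) hp⟩
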